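/- **Setting.** Let $N\ge 1$ and let $\Psi=(\psi_{ij})$ be a nonnegative symmetric $N\times N$ matrix whose graph on $\{1,\dots,N\}$, with edge set $E=\{(j,i):\psi_{ij}>0\}$, is connected. Put $\psi_u=\max_{(i,j)\in E}\psi_{ji}$ and $\psi_l=\min_{(i,j)\in E}\psi_{ji}$. Let $m,K>0$, $0<\alpha<\pi/2$, $\Omega\in\mathbb R^N$, and let $(\theta,\omega)$, continuous on $[0,\infty)$, solve, for all $t>0$ and $1\le i\le N$, $$\dot\theta_i=\omega_i,\qquad m\ddot\theta_i+\dot\theta_i=\Omega_i+\frac KN\sum_{j=1}^N\psi_{ij}\sin(\theta_j-\theta_i+\alpha).$$ For $z\in\mathbb R^N$ write $D(z)=\max_i z_i-\min_i z_i$, and $D_\theta(t)=D(\theta(t))$, $D_\omega(t)=D(\omega(t))$. For a constant $c>0$ put $S=\sum_{n=0}^{N-1}c^n$, $\eta=1-2c^{-1}$ and $$Y_c(z)=\frac1S\sum_{i=1}^N c^{i-1}z_{l_i}-\frac1S\sum_{i=1}^N c^{N-i}z_{l_i},\qquad z_{l_1}\le z_{l_2}\le\dots\le z_{l_N},$$ where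 $l_1\cdots l_N$ is a permutation that orders $z$ increasingly. With $a=\dot\omega$ and $b=\dot a$ (one-sided derivatives at $t=0$) define $$\mathcal E_2(t)=Y_c(\omega(t))+\frac{\eta\psi_l}{2N\psi_uS}\,m\,Y_c(a(t))+2m^2\,Y_c(b(t)).$$ **Assumptions.** There are $\beta\in(0,\pi)$ and constants $\gamma,D^\infty,\delta,c$ such that the following hold. (H1) $2mD(\Omega)+4mK\psi_u\sin\alpha+(1+4mK\psi_u\cos\alpha)D_\theta(0)+3mD_\omega(0)<\beta$. (H2) $\beta<\gamma<\pi$, $\;0<D^\infty<\min\{\frac\pi2,\beta\}$, $\;\alpha<\delta<\frac\pi2-D^\infty$, $\;c>\max\left\{\frac{2}{\cos(D^\infty+\delta)},\frac{2}{1-\beta/\gamma}\right\}$. (H3) $$mK<\min\left\{\frac{\eta^2\psi_l\sin\gamma}{16N\psi_u^2S\gamma},\frac{NS}{2\psi_l}\right\},\qquad K>\frac{4(D(\Omega)+2K\psi_u\sin\alpha)NS\gamma}{D^\infty\eta\psi_l\cos\alpha\sin\gamma},$$ $$K>\frac{64(D(\Omega)+2K\psi_u\sin\alpha)(D^\infty\cos\alpha+\sin\alpha)N^3\psi_u^2S^3\gamma^2}{\eta^3\psi_l^3\cos\alpha\sin^2\gamma}.$$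 (For $N=1$ it is part of (H3) that $\psi_{11}>0$, so that $\psi_l$ and $\psi_u$ are defined.) **Theorem.** Let $\Lambda=\dfrac{K\psi_l}{2NS}$, which is positive. There is a time $t_*\ge0$ such that $$D_\omega(t)\le Ce^{-\Lambda(t-t_*)}\qquad\text{for all }t\ge t_*$$ with $C=\mathcal E_2(t_*)/\eta$; in particular the bound holds, for the same $t_*$ and $\Lambda$, with some positive constant $C$. -/

import Mathlib

open Real Set

noncomputable section

namespace Kuramoto

/-- Diameter `max_i z_i - min_i z_i` of a finite tuple of reals. -/
def diam {N : ℕ} (z : Fin N → ℝ) : ℝ := (⨆ i, z i) - ⨅ i, z i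

/-- Edge set `E = {(j, i) | ψ_{ij} > 0}` of the weighted graph with weights `ψ`;
`ψ i j` is the weight of the edge from `j` to `i`. -/
def edges {N : ℕ} (ψ : Fin N → Fin N → ℝ) : Set (Fin N × Fin N) := {p | 0 < ψ p.2 p.1}

/-- `ψ_u`, the largest weight of an edge. -/
def psiU {N : ℕ} (ψ : Fin N → Fin N → ℝ) : ℝ := sSup ((fun p => ψ p.2 p.1) '' edges ψ)

/-- `ψ_l`, the smallest weight of an edge. -/
def psiL {N : ℕ} (ψ : Fin N → Fin N → ℝ) : ℝ := sInf ((fun p => ψ p.2 p.1) '' edges ψ)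

/-- A symmetric, connected weighted graph on `{1, …, N}` (loops are allowed). -/
structure IsSymmConnected {N : ℕ} (ψ : Fin N → Fin N → ℝ) : Prop where
  nonneg : ∀ i j, 0 ≤ ψ i j
  symm : ∀ i j, ψ i j = ψ j i
  connected : (SimpleGraph.fromRel fun j i => (j, i) ∈ edges ψ).Connected

/-- `(θ, ω)` is a solution on `[0, ∞)` of the inertial Kuramoto model with frustration `α`:
`ω_i = θ_i'` and `m θ_i'' + θ_i' = Ω_i + (K / N) ∑_j ψ_{ij} sin (θ_j - θ_i + α)` for `t > 0`,
with `θ` and `ω` continuous up to the initial time `t = 0`. -/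
structure IsSolution {N : ℕ} (ψ : Fin N → Fin N → ℝ) (Ω : Fin N → ℝ) (m K α : ℝ)
    (θ ω : ℝ → Fin N → ℝ) : Prop where
  continuousOn_phase : ∀ i, ContinuousOn (fun t => θ t i) (Ici 0)
  continuousOn_freq : ∀ i, ContinuousOn (fun t => ω t i) (Ici 0)
  hasDerivAt_phase : ∀ t, 0 < t → ∀ i, HasDerivAt (fun s => θ s i) (ω t i) t
  differentiableAt_freq : ∀ t, 0 < t → ∀ i, DifferentiableAt ℝ (fun s => ω s i) t
  equation : ∀ t, 0 < t → ∀ i,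
    m * deriv (fun s => ω s i) t + ω t i =
      Ω i + K / N * ∑ j, ψ i j * sin (θ t j - θ t i + α)

/-- Time derivative on `[0, ∞)` of a vector-valued function, by components
(the one-sided derivative at `t = 0`). -/
def dot {N : ℕ} (z : ℝ → Fin N → ℝ) (t : ℝ) (i : Fin N) : ℝ :=
  derivWithin (fun s => z s i) (Ici 0) t

/-- `∑_{n=0}^{N-1} c^n`. -/
def geom (N : ℕ) (c : ℝ) : ℝ := ∑ n ∈ Finset.range N, c ^ n

/-- `η = 1 - 2 c⁻¹`. -/
def eta (c : ℝ) : ℝ := 1 - 2 * c⁻¹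

/-- The difference `z̄ - z̲` of the two convex combinations of the entries of `z`, where
`z_{l_1} ≤ ⋯ ≤ z_{l_N}` is the increasing rearrangement of `z`,
`z̄ = (∑ c^n)⁻¹ ∑_{i=1}^N c^{i-1} z_{l_i}` and `z̲ = (∑ c^n)⁻¹ ∑_{i=1}^N c^{N-i} z_{l_i}`.
The index `i : Fin N` starts at `0`; `Tuple.sort z` is a permutation with `z ∘ Tuple.sort z`
monotone, and the rearranged tuple does not depend on how ties are ordered. -/
def combDiff {N : ℕ} (c : ℝ) (z : Fin N → ℝ) : ℝ :=
  1 / geom N c * ∑ i : Fin N, c ^ (i : ℕ) * z (Tuple.sort z i) -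
    1 / geom N c * ∑ i : Fin N, c ^ (N - 1 - (i : ℕ)) * z (Tuple.sort z i)

/-- The energy `𝓔₂ = F + (η ψ_l / (2 N ψ_u ∑ c^n)) m A + 2 m² B`, where `F`, `A`, `B` are the
differences of convex combinations of the frequencies `ω`, the accelerations `ω'` and the
jerks `ω''`. -/
def energy₂ {N : ℕ} (ψ : Fin N → Fin N → ℝ) (m c : ℝ) (ω : ℝ → Fin N → ℝ) (t : ℝ) : ℝ :=
  combDiff c (ω t) +
    eta c * psiL ψ / (2 * N * psiU ψ * geom N c) * m * combDiff c (dot ω t) +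
    2 * m ^ 2 * combDiff c (dot (dot ω) t)

/-- Condition `(H1)` on the initial data `θ0 = θ(0)`, `ω0 = ω(0)`. -/
def H1 {N : ℕ} (ψ : Fin N → Fin N → ℝ) (Ω : Fin N → ℝ) (m K α β : ℝ)
    (θ0 ω0 : Fin N → ℝ) : Prop :=
  2 * m * diam Ω + 4 * m * K * psiU ψ * sin α +
    (1 + 4 * m * K * psiU ψ * cos α) * diam θ0 + 3 * m * diam ω0 < β

/-- Condition `(H2)` on the auxiliary constants; `Dinf` is `D^∞`. -/
structure H2 (α β γ Dinf δ c : ℝ) : Prop where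
  beta_lt_gamma : β < γ
  gamma_lt_pi : γ < π
  Dinf_pos : 0 < Dinf
  Dinf_lt : Dinf < min (π / 2) β
  alpha_lt_delta : α < δ
  delta_lt : δ < π / 2 - Dinf
  lt_c : max (2 / cos (Dinf + δ)) (2 / (1 - β / γ)) < c

/-- Condition `(H3)` on the coupling strength `K` and the inertia `m`. -/
structure H3 {N : ℕ} (ψ : Fin N → Fin N → ℝ) (Ω : Fin N → ℝ) (m K α γ Dinf c : ℝ) : Prop where
  mK_lt : m * K < min
    (eta c ^ 2 * psiL ψ * sin γ / (16 * N * psiU ψ ^ 2 * geom N c * γ))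
    (N * geom N c / (2 * psiL ψ))
  lt_K : 4 * (diam Ω + 2 * K * psiU ψ * sin α) * N * geom N c * γ /
    (Dinf * eta c * psiL ψ * cos α * sin γ) < K
  lt_K' : 64 * (diam Ω + 2 * K * psiU ψ * sin α) * (Dinf * cos α + sin α) *
      N ^ 3 * psiU ψ ^ 2 * geom N c ^ 3 * γ ^ 2 /
    (eta c ^ 3 * psiL ψ ^ 3 * cos α * sin γ ^ 2) < K

/-- The decay rate `Λ = K ψ_l / (2 N ∑ c^n)`. -/
def rate {N : ℕ} (ψ : Fin N → Fin N → ℝ) (K c : ℝ) : ℝ :=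
  K * psiL ψ / (2 * N * geom N c)

end Kuramoto

end

/-! On a merely connected graph the largest and the smallest entry need not interact, so the
diameter itself need not decrease. `combDiff c` replaces it. It lies between `eta c * diam` and
`diam`, and it is a maximum of finitely many linear functionals, so its upper Dini derivative is
governed by the permutations that sort the current state (`upperDini_combDiff`). Its geometric
weights make the downward pull on the higher member of each pair outweigh the upward pull on the
lower one by a factor of at least `c`. Every edge therefore contributes decay, and a path from the
minimum to the maximum turns the edge contributions into a multiple of the diameter
(`wdiff_couple_le`).

Inertia is treated as a perturbation. From `ω = force - m a` and `a = lin - m b`, phases and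
frequencies follow first-order consensus dynamics up to errors `m a` and `m b`. Accelerations and
jerks are damped at rate `1/m` towards inputs bounded by lower-order diameters. Adding them to the
energy with suitable weights lets their damping absorb the errors, because `m K` is small
(`upperDini_energyPhase`, `upperDini_energyFreq`).

The phase energy stays below `β`, which keeps the phase diameter below `γ < π`, where the sine
coupling is still attractive; it then falls until the diameter is at most `Dinf`. From then on all
cosines exceed `2/c` and the frequencies satisfy a linear consensus equation. The one nonlinear
term, quadratic in the frequency diameter, is handled by a bootstrap: a crude eventual bound gives
decay at rate `Λ/2`, after which that term is small enough for the full rate `Λ`. -/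

namespace Kuramoto

open Filter Topology

/-! ### Dini derivatives and differential inequalities. -/

/-- The upper right Dini derivative of `f` at `x` is at most `d`. -/
def UpperDini (f : ℝ → ℝ) (x d : ℝ) : Prop :=
  ∀ r, d < r → ∀ᶠ z in 𝓝[>] x, f z < f x + r * (z - x)

namespace UpperDini

variable {f g : ℝ → ℝ} {x d e k : ℝ}

theorem mono (h : UpperDini f x d) (hde : d ≤ e) : UpperDini f x e :=
  fun r hr => h r (hde.trans_lt hr)

theorem add (hf : UpperDini f x d) (hg : UpperDini g x e) :
    UpperDini (fun t => f t + g t) x (d + e) := by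
  intro r hr
  filter_upwards [hf (d + (r - (d + e)) / 2) (by linarith),
    hg (e + (r - (d + e)) / 2) (by linarith)] with z h1 h2
  linear_combination h1 + h2

theorem const_mul (hk : 0 < k) (hf : UpperDini f x d) :
    UpperDini (fun t => k * f t) x (k * d) := by
  intro r hr
  filter_upwards [hf (r / k) (by rwa [lt_div_iff₀' hk])] with z h1
  have := mul_lt_mul_of_pos_left h1 hk
  have e1 : k * (f x + r / k * (z - x)) = k * f x + r * (z - x) := by field_simp
  linarith

theorem frequently_slope_lt (hf : UpperDini f x d) {r : ℝ} (hr : d < r) :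
    ∃ᶠ z in 𝓝[>] x, (z - x)⁻¹ * (f z - f x) < r := by
  apply Eventually.frequently
  filter_upwards [hf r hr, self_mem_nhdsWithin] with z hz hzx
  have : 0 < z - x := sub_pos.2 hzx
  rw [inv_mul_lt_iff₀ this]
  linarith

end UpperDini

/-- A barrier argument: the derivative is controlled only on the level `b` itself, so it applies
before any a priori bound is known. -/
theorem le_of_upperDini_neg_at_level {f : ℝ → ℝ} {T b d : ℝ} (hf : ContinuousOn f (Ici T))
    (hT : f T ≤ b) (hd : d < 0) (h : ∀ t, T ≤ t → f t = b → UpperDini f t d) :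
    ∀ t, T ≤ t → f t ≤ b := by
  intro t ht
  have hcont : ContinuousOn f (Icc T t) := hf.mono Icc_subset_Ici_self
  have hcl : IsClosed ({x | f x ≤ b} ∩ Icc T t) := by
    rw [inter_comm]
    exact hcont.preimage_isClosed_of_isClosed isClosed_Icc isClosed_Iic
  refine hcl.Icc_subset_of_forall_exists_gt hT ?_ (right_mem_Icc.2 ht)
  rintro x ⟨hx, hxT⟩ y hy
  have hev : ∀ᶠ z in 𝓝[>] x, f z ≤ b := by
    rcases (show f x ≤ b from hx).lt_or_eq with hlt | heq
    · have hc : ContinuousWithinAt f (Ioi x) x :=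
        (hf x hxT.1).mono fun z hz => hxT.1.trans (le_of_lt hz)
      exact (hc.eventually_lt_const hlt).mono fun z hz => hz.le
    · filter_upwards [h x hxT.1 heq 0 hd] with z hz
      linarith
  obtain ⟨z, hz, hz'⟩ := (hev.and (Ioc_mem_nhdsGT hy)).exists
  exact ⟨z, hz, hz'⟩

theorem le_exp_of_upperDini {f : ℝ → ℝ} {T C r : ℝ} (hr : 0 < r) (hf : ContinuousOn f (Ici T))
    (h : ∀ t, T ≤ t → UpperDini f t (C - r * f t)) :
    ∀ t, T ≤ t → f t ≤ C / r + (f T - C / r) * exp (-r * (t - T)) := by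
  intro t ht
  have := le_gronwallBound_of_liminf_deriv_right_le (f := f) (f' := fun t => C - r * f t)
    (δ := f T) (K := -r) (ε := C) (a := T) (b := t) (hf.mono Icc_subset_Ici_self)
    (fun x hx s hs => (h x hx.1).frequently_slope_lt hs) le_rfl
    (fun x _ => by linarith) t (right_mem_Icc.2 ht)
  rw [gronwallBound_of_K_ne_0 (neg_ne_zero.2 hr.ne')] at this
  refine this.trans_eq ?_
  field_simp
  ring

theorem eventually_le_of_upperDini {f : ℝ → ℝ} {T C r M : ℝ} (hr : 0 < r)
    (hf : ContinuousOn f (Ici T)) (h : ∀ t, T ≤ t → UpperDini f t (C - r * f t))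
    (hM : C / r < M) : ∀ᶠ t in atTop, f t ≤ M := by
  have hlim : Tendsto (fun t => C / r + (f T - C / r) * exp (-r * (t - T))) atTop
      (𝓝 (C / r + (f T - C / r) * 0)) := by
    refine tendsto_const_nhds.add (tendsto_const_nhds.mul (tendsto_exp_atBot.comp ?_))
    exact (tendsto_atTop_add_const_right _ (-T) tendsto_id).const_mul_atTop_of_neg
      (neg_neg_of_pos hr)
  rw [mul_zero, add_zero] at hlim
  filter_upwards [hlim.eventually_lt_const hM, eventually_ge_atTop T] with t h1 h2
  exact (le_exp_of_upperDini hr hf h t h2).trans h1.le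

theorem _root_.HasDerivAt.upperDini {f : ℝ → ℝ} {x d : ℝ} (h : HasDerivAt f d x) :
    UpperDini f x d := by
  intro r hr
  have h1 := (hasDerivWithinAt_iff_tendsto_slope.1 (h.hasDerivWithinAt (s := Ioi x)))
  rw [sdiff_singleton_eq_self self_notMem_Ioi] at h1
  filter_upwards [h1.eventually_lt_const hr, self_mem_nhdsWithin] with z hz hzx
  have : 0 < z - x := sub_pos.2 hzx
  rw [slope_def_field, div_lt_iff₀ this] at hz
  linarith

/-! ### Diameters of finite tuples. -/

section Diameter

variable {N : ℕ}

theorem sub_le_diam (z : Fin N → ℝ) (i j : Fin N) : z i - z j ≤ diam z :=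
  sub_le_sub (le_ciSup (finite_range z).bddAbove i) (ciInf_le (finite_range z).bddBelow j)

theorem diam_le [NeZero N] {z : Fin N → ℝ} {d : ℝ} (h : ∀ i j, z i - z j ≤ d) : diam z ≤ d := by
  obtain ⟨i, hi⟩ := exists_eq_ciSup_of_finite (f := z)
  obtain ⟨j, hj⟩ := exists_eq_ciInf_of_finite (f := z)
  rw [diam, ← hi, ← hj]
  exact h i j

theorem diam_nonneg [NeZero N] (z : Fin N → ℝ) : 0 ≤ diam z := by
  simpa using sub_le_diam z 0 0

theorem abs_sub_le_diam (z : Fin N → ℝ) (i j : Fin N) : |z i - z j| ≤ diam z :=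
  abs_sub_le_iff.2 ⟨sub_le_diam z i j, sub_le_diam z j i⟩

theorem diam_le_of_abs_le [NeZero N] {z : Fin N → ℝ} {M : ℝ} (h : ∀ i, |z i| ≤ M) :
    diam z ≤ 2 * M :=
  diam_le fun i j => by linarith [abs_le.1 (h i), abs_le.1 (h j)]

end Diameter

/-! ### Geometrically weighted averages of sorted tuples. -/

section WeightedSums

variable {N : ℕ} {c : ℝ}

/-- The average of the entries of `z`, taken in the order `σ`, with weights `c ^ i`. -/
noncomputable def wavg (c : ℝ) (σ : Equiv.Perm (Fin N)) (z : Fin N → ℝ) : ℝ :=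
  1 / geom N c * ∑ i : Fin N, c ^ (i : ℕ) * z (σ i)

/-- The weighted average for the increasing order. -/
noncomputable def uavg (c : ℝ) (z : Fin N → ℝ) : ℝ := wavg c (Tuple.sort z) z

theorem geom_eq (N : ℕ) (c : ℝ) : geom N c = ∑ i : Fin N, c ^ (i : ℕ) :=
  Finset.sum_range _

theorem one_le_geom [NeZero N] (hc : 0 ≤ c) : 1 ≤ geom N c := by
  obtain ⟨n, rfl⟩ := Nat.exists_eq_succ_of_ne_zero (NeZero.ne N)
  rw [geom, Finset.sum_range_succ', pow_zero]
  linarith [Finset.sum_nonneg fun i (_ : i ∈ Finset.range n) => pow_nonneg hc (i + 1)]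

theorem wavg_add (σ : Equiv.Perm (Fin N)) (y z : Fin N → ℝ) :
    wavg c σ (y + z) = wavg c σ y + wavg c σ z := by
  simp [wavg, mul_add, Finset.sum_add_distrib]

theorem wavg_smul (σ : Equiv.Perm (Fin N)) (k : ℝ) (z : Fin N → ℝ) :
    wavg c σ (k • z) = k * wavg c σ z := by
  simp only [wavg, Pi.smul_apply, smul_eq_mul, Finset.mul_sum]
  exact Finset.sum_congr rfl fun i _ => by ring

theorem wavg_neg (σ : Equiv.Perm (Fin N)) (z : Fin N → ℝ) :
    wavg c σ (-z) = -wavg c σ z := by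
  simp [wavg]

theorem wavg_le [NeZero N] (hc : 0 < c) (σ : Equiv.Perm (Fin N)) {z : Fin N → ℝ} {M : ℝ}
    (h : ∀ i, z i ≤ M) : wavg c σ z ≤ M := by
  have hS : 0 < geom N c := one_pos.trans_le (one_le_geom hc.le)
  rw [wavg, one_div, inv_mul_le_iff₀ hS, geom_eq, Finset.sum_mul]
  exact Finset.sum_le_sum fun i _ => mul_le_mul_of_nonneg_left (h _) (pow_nonneg hc.le _)

/-- Rearrangement inequality: increasing weights are best paired with increasing entries. -/
theorem wavg_le_uavg [NeZero N] (hc : 1 < c) (σ : Equiv.Perm (Fin N)) (z : Fin N → ℝ) :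
    wavg c σ z ≤ uavg c z := by
  have hS : 0 < geom N c := one_pos.trans_le (one_le_geom (by linarith))
  refine mul_le_mul_of_nonneg_left ?_ (one_div_nonneg.2 hS.le)
  have hmono : Monovary (fun i : Fin N => c ^ (i : ℕ)) (z ∘ Tuple.sort z) := by
    apply Monotone.monovary
    · intro i j hij
      exact pow_le_pow_right₀ hc.le hij
    · exact Tuple.monotone_sort z
  have := hmono.sum_mul_comp_perm_le_sum_mul (σ := σ.trans (Tuple.sort z).symm)
  simpa using this

theorem uavg_eq_of_monotone {σ : Equiv.Perm (Fin N)} {z : Fin N → ℝ} (h : Monotone (z ∘ σ)) :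
    uavg c z = wavg c σ z := by
  have := Tuple.comp_sort_eq_comp_iff_monotone.2 h
  simp only [uavg, wavg]
  congr 1
  exact Finset.sum_congr rfl fun i _ => by rw [show z (σ i) = _ from congrFun this i]; rfl

/-- Sorting `-z` reverses the order of `z`, so lower averages reduce to upper ones and only `uavg`
needs study. -/
theorem combDiff_eq (z : Fin N → ℝ) : combDiff c z = uavg c z + uavg c (-z) := by
  have hm : Monotone ((-z) ∘ (Fin.revPerm.trans (Tuple.sort z))) := by
    intro i j hij
    simpa using Tuple.monotone_sort z (Fin.rev_le_rev.2 hij)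
  rw [uavg_eq_of_monotone hm, wavg_neg, combDiff, ← sub_eq_add_neg]
  congr 2
  rw [← Equiv.sum_comp Fin.revPerm]
  refine Finset.sum_congr rfl fun i _ => ?_
  simp only [Fin.revPerm_apply, Fin.val_rev, Equiv.trans_apply]
  congr 2
  omega

/-- The difference of a weighted average of `z` and a reversed one; `combDiff c z` is the largest
value over all pairs of permutations. -/
noncomputable def wdiff (c : ℝ) (σ τ : Equiv.Perm (Fin N)) (z : Fin N → ℝ) : ℝ :=
  wavg c σ z + wavg c τ (-z)

theorem wdiff_add (σ τ : Equiv.Perm (Fin N)) (y z : Fin N → ℝ) :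
    wdiff c σ τ (y + z) = wdiff c σ τ y + wdiff c σ τ z := by
  simp only [wdiff, wavg_add, wavg_neg]
  ring

theorem wdiff_smul (σ τ : Equiv.Perm (Fin N)) (k : ℝ) (z : Fin N → ℝ) :
    wdiff c σ τ (k • z) = k * wdiff c σ τ z := by
  simp only [wdiff, wavg_smul, wavg_neg]
  ring

theorem wdiff_le [NeZero N] (hc : 1 < c) (σ τ : Equiv.Perm (Fin N))
    (z : Fin N → ℝ) : wdiff c σ τ z ≤ combDiff c z := by
  rw [combDiff_eq]
  exact add_le_add (wavg_le_uavg hc σ z) (wavg_le_uavg hc τ (-z))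

theorem neg_combDiff_le_wdiff [NeZero N] (hc : 1 < c) (σ τ : Equiv.Perm (Fin N))
    (z : Fin N → ℝ) : -combDiff c z ≤ wdiff c σ τ z := by
  have := wdiff_le hc τ σ z
  simp only [wdiff, wavg_neg] at this ⊢
  linarith

theorem wdiff_eq_of_monotone {σ τ : Equiv.Perm (Fin N)} {z : Fin N → ℝ}
    (hσ : Monotone (z ∘ σ)) (hτ : Monotone ((-z) ∘ τ)) : wdiff c σ τ z = combDiff c z := by
  rw [combDiff_eq, uavg_eq_of_monotone hσ, uavg_eq_of_monotone hτ, wdiff]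

theorem combDiff_le_diam [NeZero N] (hc : 0 < c) (z : Fin N → ℝ) : combDiff c z ≤ diam z := by
  obtain ⟨i, hi⟩ := Finite.exists_max z
  obtain ⟨j, hj⟩ := Finite.exists_min z
  rw [combDiff_eq]
  have h1 : uavg c z ≤ z i := wavg_le hc _ hi
  have h2 : uavg c (-z) ≤ -z j := wavg_le hc _ fun k => neg_le_neg (hj k)
  linarith [sub_le_diam z i j]

/-- All weights but the top one add up to at most a fraction `1/c` of the total, and each of those
entries is below `z p` by at most the diameter. Using this at both ends produces the `2/c` in `eta`.
-/
theorem sub_diam_div_le_uavg [NeZero N] (hc : 1 < c) (z : Fin N → ℝ) (p : Fin N) :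
    z p - diam z / c ≤ uavg c z := by
  have hc0 : 0 < c := by linarith
  obtain ⟨n, rfl⟩ := Nat.exists_eq_succ_of_ne_zero (NeZero.ne N)
  have hS : 0 < geom (n + 1) c := one_pos.trans_le (one_le_geom hc0.le)
  have hlast : z p ≤ z (Tuple.sort z (Fin.last n)) := by
    have := Tuple.monotone_sort z (Fin.le_last ((Tuple.sort z).symm p))
    simpa using this
  have hgeom : c * ∑ i : Fin n, c ^ (i : ℕ) ≤ geom (n + 1) c := by
    rw [geom, Finset.sum_range_succ', ← Finset.sum_range (fun i => c ^ i), Finset.mul_sum]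
    simp [pow_succ']
  have hD : 0 ≤ diam z := diam_nonneg z
  have hsum : ∑ i : Fin (n + 1), c ^ (i : ℕ) * z (Tuple.sort z i) ≥
      geom (n + 1) c * z p - (∑ i : Fin n, c ^ (i : ℕ)) * diam z := by
    rw [Fin.sum_univ_castSucc, geom_eq, Fin.sum_univ_castSucc, add_mul, Finset.sum_mul,
      Finset.sum_mul]
    have h1 : ∑ i : Fin n, c ^ (i : ℕ) * z p - ∑ i : Fin n, c ^ (i : ℕ) * diam z ≤
        ∑ i : Fin n, c ^ (i : ℕ) * z (Tuple.sort z i.castSucc) := by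
      rw [← Finset.sum_sub_distrib]
      refine Finset.sum_le_sum fun i _ => ?_
      rw [← mul_sub]
      exact mul_le_mul_of_nonneg_left (by linarith [sub_le_diam z p (Tuple.sort z i.castSucc)])
        (by positivity)
    have h2 := mul_le_mul_of_nonneg_left hlast (pow_nonneg hc0.le n)
    simp only [Fin.val_castSucc, Fin.val_last]
    linarith
  rw [uavg, wavg, one_div, le_inv_mul_iff₀ hS]
  refine le_trans ?_ hsum
  have h3 : (∑ i : Fin n, c ^ (i : ℕ)) ≤ geom (n + 1) c / c := by rwa [le_div_iff₀' hc0]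
  have h4 := mul_le_mul_of_nonneg_right h3 hD
  have e : geom (n + 1) c * (z p - diam z / c) =
    geom (n + 1) c * z p - geom (n + 1) c / c * diam z := by ring
  linarith

theorem diam_neg_le [NeZero N] (z : Fin N → ℝ) : diam (-z) ≤ diam z :=
  diam_le fun i j => by simpa [add_comm, ← sub_eq_add_neg] using sub_le_diam z j i

theorem eta_mul_diam_le [NeZero N] (hc : 1 < c) (z : Fin N → ℝ) :
    eta c * diam z ≤ combDiff c z := by
  have hc0 : 0 < c := by linarith
  obtain ⟨i, hi⟩ := Finite.exists_max z
  obtain ⟨j, hj⟩ := Finite.exists_min z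
  rw [combDiff_eq]
  have h1 := sub_diam_div_le_uavg hc z i
  have h2 := sub_diam_div_le_uavg hc (-z) j
  have h3 : diam (-z) / c ≤ diam z / c := div_le_div_of_nonneg_right (diam_neg_le z) hc0.le
  have h4 : diam z ≤ z i - z j := diam_le fun p q => sub_le_sub (hi p) (hj q)
  simp only [Pi.neg_apply] at h2
  have e : eta c * diam z = diam z - diam z / c - diam z / c := by rw [eta]; ring
  linarith

theorem combDiff_nonneg [NeZero N] (hc : 1 < c) (z : Fin N → ℝ) : 0 ≤ combDiff c z := by
  have := wdiff_le hc 1 1 z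
  rwa [wdiff, wavg_neg, add_neg_cancel] at this

theorem uavg_eq_sup [NeZero N] (hc : 1 < c) (z : Fin N → ℝ) :
    uavg c z = Finset.univ.sup' Finset.univ_nonempty fun σ : Equiv.Perm (Fin N) => wavg c σ z :=
  le_antisymm (Finset.le_sup' (fun σ => wavg c σ z) (Finset.mem_univ (Tuple.sort z)))
    (Finset.sup'_le _ _ fun σ _ => wavg_le_uavg hc σ z)

theorem continuous_uavg [NeZero N] (hc : 1 < c) : Continuous (uavg c : (Fin N → ℝ) → ℝ) := by
  rw [funext (uavg_eq_sup hc)]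
  refine Continuous.finset_sup'_apply _ fun σ _ => ?_
  unfold wavg
  fun_prop

theorem continuous_combDiff [NeZero N] (hc : 1 < c) :
    Continuous (combDiff c : (Fin N → ℝ) → ℝ) := by
  rw [funext combDiff_eq]
  exact (continuous_uavg hc).add ((continuous_uavg hc).comp continuous_neg)

/-- By continuity, a permutation that does not sort `z t` cannot sort `z s` for `s` close to `t`.
Only the finitely many sorting permutations at time `t` (several when there are ties) compete, and
each gives a differentiable function. -/
theorem upperDini_uavg [NeZero N] {z : ℝ → Fin N → ℝ} {z' : Fin N → ℝ} {t d : ℝ}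
    (hz : ∀ i, HasDerivAt (fun s => z s i) (z' i) t)
    (h : ∀ σ : Equiv.Perm (Fin N), Monotone (z t ∘ σ) → wavg c σ z' ≤ d) :
    UpperDini (fun s => uavg c (z s)) t d := by
  intro r hr
  have key : ∀ σ : Equiv.Perm (Fin N), ∀ᶠ s in 𝓝[>] t,
      Tuple.sort (z s) = σ → uavg c (z s) < uavg c (z t) + r * (s - t) := by
    intro σ
    by_cases hσ : Monotone (z t ∘ σ)
    · have hd : HasDerivAt (fun s => wavg c σ (z s)) (wavg c σ z') t := by
        unfold wavg
        exact (HasDerivAt.fun_sum fun i _ => (hz (σ i)).const_mul _).const_mul _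
      filter_upwards [hd.upperDini r ((h σ hσ).trans_lt hr)] with s hs hsσ
      rw [uavg_eq_of_monotone hσ, uavg, hsσ]
      exact hs
    · simp only [Monotone, not_forall, not_le, Function.comp_apply] at hσ
      obtain ⟨i, j, hij, hlt⟩ := hσ
      have h1 := ((hz (σ j)).continuousAt.eventually_lt (hz (σ i)).continuousAt hlt).filter_mono
        (nhdsWithin_le_nhds (s := Ioi t))
      filter_upwards [h1] with s hs hsσ
      have := Tuple.monotone_sort (z s) hij
      rw [hsσ] at this
      exact absurd this (not_le.2 hs)
  filter_upwards [eventually_all.2 key] with s hs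
  exact hs _ rfl

theorem upperDini_combDiff [NeZero N] {z : ℝ → Fin N → ℝ} {z' : Fin N → ℝ} {t d : ℝ}
    (hz : ∀ i, HasDerivAt (fun s => z s i) (z' i) t)
    (h : ∀ σ τ : Equiv.Perm (Fin N), Monotone (z t ∘ σ) → Monotone ((-z t) ∘ τ) →
      wdiff c σ τ z' ≤ d) :
    UpperDini (fun s => combDiff c (z s)) t d := by
  -- The worst `σ₀` for the upper average splits `d` into separate bounds for the two averages.
  obtain ⟨σ₀, hσ₀, hmax⟩ := (Finset.univ.filter fun σ : Equiv.Perm (Fin N) =>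
    Monotone (z t ∘ σ)).exists_max_image (fun σ => wavg c σ z')
    ⟨Tuple.sort (z t), by simpa using Tuple.monotone_sort (z t)⟩
  simp only [Finset.mem_filter, Finset.mem_univ, true_and] at hσ₀ hmax
  simp_rw [combDiff_eq]
  have h1 : UpperDini (fun s => uavg c (z s)) t (wavg c σ₀ z') := upperDini_uavg hz hmax
  have h2 : UpperDini (fun s => uavg c (-z s)) t (d - wavg c σ₀ z') :=
    upperDini_uavg (z := fun s => -z s) (z' := -z') (fun i => (hz i).neg)
      fun τ hτ => le_sub_iff_add_le'.2 (h σ₀ τ hσ₀ hτ)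
  simpa using h1.add h2

end WeightedSums

/-! ### Dissipation produced by the coupling on a connected graph. -/

section Network

variable {N : ℕ} {ψ : Fin N → Fin N → ℝ}

theorem psiU_nonneg : 0 ≤ psiU ψ := by
  apply Real.sSup_nonneg
  rintro _ ⟨p, hp, rfl⟩
  exact le_of_lt hp

theorem le_psiU (i j : Fin N) : ψ i j ≤ psiU ψ := by
  by_cases h : 0 < ψ i j
  · exact le_csSup ((toFinite (edges ψ)).image _).bddAbove ⟨(j, i), h, rfl⟩
  · exact (not_lt.1 h).trans psiU_nonneg

theorem psiL_le {i j : Fin N} (h : 0 < ψ i j) : psiL ψ ≤ ψ i j :=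
  csInf_le ((toFinite (edges ψ)).image _).bddBelow ⟨(j, i), h, rfl⟩

theorem psiL_nonneg : 0 ≤ psiL ψ := by
  apply Real.sInf_nonneg
  rintro _ ⟨p, hp, rfl⟩
  exact le_of_lt hp

theorem psiL_le_psiU : psiL ψ ≤ psiU ψ := by
  rcases (edges ψ).eq_empty_or_nonempty with h | ⟨p, hp⟩
  · simp [psiL, psiU, h]
  · exact (psiL_le hp).trans (le_psiU _ _)

theorem sub_le_sum_darts {V : Type*} {G : SimpleGraph V} (x : V → ℝ) {a b : V} (w : G.Walk a b) :
    x b - x a ≤ (w.darts.map fun d => max (x d.snd - x d.fst) 0).sum := by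
  induction w with
  | nil => simp
  | cons h w ih =>
    simp only [SimpleGraph.Walk.darts_cons, List.map_cons, List.sum_cons]
    rename_i u v _
    linarith [le_max_left (x v - x u) 0]

/-- The positive increments along a path from an argmin to an argmax add up to at least the
diameter, and a path uses each directed edge at most once. The factor 2 comes from splitting `|x p -
x q|` into its two positive parts, whose sums agree by symmetry. -/
theorem IsSymmConnected.two_mul_psiL_mul_diam_le [NeZero N] (hψ : IsSymmConnected ψ)
    (x : Fin N → ℝ) : 2 * psiL ψ * diam x ≤ ∑ p, ∑ q, ψ p q * |x p - x q| := by
  classical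
  have hdiam : ∀ a b, psiL ψ * (x b - x a) ≤ ∑ p, ∑ q, ψ p q * max (x q - x p) 0 := by
    intro a b
    obtain ⟨w, hw⟩ := hψ.connected.exists_isPath a b
    set f : Fin N × Fin N → ℝ := fun p => max (x p.2 - x p.1) 0 with hf
    set L := w.darts.map fun d => d.toProd with hL
    have hnd : L.Nodup :=
      (SimpleGraph.Walk.darts_nodup_of_support_nodup hw.support_nodup).map
        SimpleGraph.Dart.toProd_injective
    have h1 : x b - x a ≤ ∑ p ∈ L.toFinset, f p := by
      refine (sub_le_sum_darts x w).trans_eq ?_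
      rw [List.sum_toFinset _ hnd, hL, List.map_map]
      rfl
    have hpos : ∀ p : Fin N × Fin N, 0 ≤ ψ p.1 p.2 * f p :=
      fun p => mul_nonneg (hψ.nonneg _ _) (le_max_right _ _)
    calc psiL ψ * (x b - x a) ≤ psiL ψ * ∑ p ∈ L.toFinset, f p :=
          mul_le_mul_of_nonneg_left h1 psiL_nonneg
      _ ≤ ∑ p ∈ L.toFinset, ψ p.1 p.2 * f p := by
          rw [Finset.mul_sum]
          refine Finset.sum_le_sum fun p hp => mul_le_mul_of_nonneg_right ?_ (le_max_right _ _)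
          rw [List.mem_toFinset, hL, List.mem_map] at hp
          obtain ⟨d, -, rfl⟩ := hp
          have := d.adj
          rw [SimpleGraph.fromRel_adj] at this
          rcases this.2 with h | h
          · rw [hψ.symm]
            exact psiL_le h
          · exact psiL_le h
      _ ≤ ∑ p, ψ p.1 p.2 * f p :=
          Finset.sum_le_sum_of_subset_of_nonneg (Finset.subset_univ _) fun p _ _ => hpos p
      _ = _ := Fintype.sum_prod_type _
  have hsplit : ∑ p, ∑ q, ψ p q * |x p - x q| =
      ∑ p, ∑ q, ψ p q * max (x q - x p) 0 + ∑ p, ∑ q, ψ p q * max (x q - x p) 0 := by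
    conv_rhs =>
      arg 2
      rw [Finset.sum_comm]
    rw [← Finset.sum_add_distrib]
    refine Finset.sum_congr rfl fun p _ => ?_
    rw [← Finset.sum_add_distrib]
    refine Finset.sum_congr rfl fun q _ => ?_
    rw [hψ.symm q p, ← mul_add]
    congr 1
    rcases le_total (x p) (x q) with h | h
    · rw [max_eq_left (by linarith), max_eq_right (by linarith), abs_of_nonpos (by linarith)]
      ring
    · rw [max_eq_right (by linarith), max_eq_left (by linarith), abs_of_nonneg (by linarith)]
      ring
  obtain ⟨i, hi⟩ := Finite.exists_max x
  obtain ⟨j, hj⟩ := Finite.exists_min x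
  have h4 : diam x ≤ x i - x j := diam_le fun p q => sub_le_sub (hi p) (hj q)
  have := mul_le_mul_of_nonneg_left h4 (psiL_nonneg (ψ := ψ))
  linarith [hdiam j i]

/-- The mean-field interaction `(K / N) ∑ j, ψ i j * g i j`. -/
noncomputable def couple (ψ : Fin N → Fin N → ℝ) (K : ℝ) (g : Fin N → Fin N → ℝ) (i : Fin N) : ℝ :=
  K / N * ∑ j, ψ i j * g i j

theorem IsSymmConnected.abs_couple_le [NeZero N] (hψ : IsSymmConnected ψ) {K M : ℝ} (hK : 0 ≤ K)
    {g : Fin N → Fin N → ℝ} (hg : ∀ i j, |g i j| ≤ M) (i : Fin N) :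
    |couple ψ K g i| ≤ K * psiU ψ * M := by
  have hN : (0 : ℝ) < N := Nat.cast_pos.2 (NeZero.pos N)
  rw [couple, abs_mul, abs_of_nonneg (by positivity)]
  have : |∑ j, ψ i j * g i j| ≤ N * (psiU ψ * M) := by
    refine (Finset.abs_sum_le_sum_abs _ _).trans ?_
    refine (Finset.sum_le_card_nsmul _ _ (psiU ψ * M) fun j _ => ?_).trans_eq (by simp)
    rw [abs_mul, abs_of_nonneg (hψ.nonneg i j)]
    exact mul_le_mul (le_psiU i j) (hg i j) (abs_nonneg _) psiU_nonneg
  calc K / N * |∑ j, ψ i j * g i j| ≤ K / N * (N * (psiU ψ * M)) := by gcongr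
    _ = K * psiU ψ * M := by field_simp

theorem IsSymmConnected.diam_couple_le [NeZero N] (hψ : IsSymmConnected ψ) {K M : ℝ} (hK : 0 ≤ K)
    {g : Fin N → Fin N → ℝ} (hg : ∀ i j, |g i j| ≤ M) :
    diam (couple ψ K g) ≤ 2 * (K * psiU ψ * M) :=
  diam_le_of_abs_le (hψ.abs_couple_le hK hg)

/-- Here `φ p q` is the action of `q` on `p`. In a pair ranked `j < i`, the higher entry is pulled
down with weight `c ^ i ≥ c * c ^ j`, so the pair contributes at most `c ^ j * (c * φ p q + φ q p)`,
with `p = σ i` and `q = σ j`, which `h2` makes negative. No oddness of `φ` is needed, so frustration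
is allowed. -/
theorem IsSymmConnected.wavg_couple_le [NeZero N] (hψ : IsSymmConnected ψ) {c k K : ℝ}
    (hc : 1 ≤ c) (hk : 0 ≤ k) (hK : 0 ≤ K) {φ : Fin N → Fin N → ℝ} {x : Fin N → ℝ}
    (h1 : ∀ p q, x q ≤ x p → φ p q ≤ 0)
    (h2 : ∀ p q, x q ≤ x p → c * φ p q + φ q p ≤ -k * (x p - x q))
    {σ : Equiv.Perm (Fin N)} (hσ : Monotone (x ∘ σ)) :
    wavg c σ (couple ψ K φ) ≤ -(K * psiL ψ * k / (N * geom N c)) * diam x := by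
  have hN : (0 : ℝ) < N := Nat.cast_pos.2 (NeZero.pos N)
  have hS : 0 < geom N c := one_pos.trans_le (one_le_geom (by linarith))
  have hc0 : 0 < c := by linarith
  set A : Fin N → Fin N → ℝ := fun i j => c ^ (i : ℕ) * (ψ (σ i) (σ j) * φ (σ i) (σ j)) with hA
  have hpair : ∀ i j, j ≤ i → A i j + A j i ≤
      -k * (ψ (σ i) (σ j) * |x (σ i) - x (σ j)|) := by
    intro i j hij
    have hx : x (σ j) ≤ x (σ i) := hσ hij
    rw [abs_of_nonneg (sub_nonneg.2 hx)]
    rcases hij.eq_or_lt with rfl | hlt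
    · have := mul_nonpos_of_nonneg_of_nonpos
        (mul_nonneg (pow_nonneg hc0.le (j : ℕ)) (hψ.nonneg (σ j) (σ j))) (h1 (σ j) (σ j) le_rfl)
      simp only [hA, sub_self, mul_zero]
      linarith
    · have hpow : c ^ (j : ℕ) * c ≤ c ^ (i : ℕ) := by
        rw [← pow_succ]
        exact pow_le_pow_right₀ hc (by exact_mod_cast hlt)
      have e1 := mul_le_mul_of_nonpos_right hpow (h1 _ _ hx)
      have e2 := mul_le_mul_of_nonneg_left (h2 _ _ hx) (pow_nonneg hc0.le (j : ℕ))
      have e3 : k * (x (σ i) - x (σ j)) ≤ c ^ (j : ℕ) * (k * (x (σ i) - x (σ j))) :=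
        le_mul_of_one_le_left (mul_nonneg hk (sub_nonneg.2 hx)) (one_le_pow₀ hc)
      have e4 := mul_le_mul_of_nonneg_left
        (show c ^ (i : ℕ) * φ (σ i) (σ j) + c ^ (j : ℕ) * φ (σ j) (σ i) ≤
          -(k * (x (σ i) - x (σ j))) by linarith) (hψ.nonneg (σ i) (σ j))
      simp only [hA]
      rw [hψ.symm (σ j) (σ i)]
      linarith
  have hpair' : ∀ i j, A i j + A j i ≤ -k * (ψ (σ i) (σ j) * |x (σ i) - x (σ j)|) := by
    intro i j
    rcases le_total j i with h | h
    · exact hpair i j h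
    · rw [add_comm, hψ.symm, abs_sub_comm]
      exact hpair j i h
  have hsum : ∑ i, ∑ j, A i j ≤ -(k * psiL ψ * diam x) := by
    have e1 : 2 * ∑ i, ∑ j, A i j = ∑ i, ∑ j, (A i j + A j i) := by
      simp only [Finset.sum_add_distrib]
      rw [Finset.sum_comm (f := fun i j => A j i)]
      ring
    have e2 : ∑ i, ∑ j, (A i j + A j i) ≤
        -k * ∑ p, ∑ q, ψ p q * |x p - x q| := by
      rw [← Equiv.sum_comp σ (fun p => ∑ q, ψ p q * |x p - x q|), Finset.mul_sum]
      refine Finset.sum_le_sum fun i _ => ?_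
      rw [← Equiv.sum_comp σ (fun q => ψ (σ i) q * |x (σ i) - x q|), Finset.mul_sum]
      exact Finset.sum_le_sum fun j _ => hpair' i j
    have e3 := mul_le_mul_of_nonneg_left (hψ.two_mul_psiL_mul_diam_le x) hk
    linarith
  have heq : wavg c σ (couple ψ K φ) = K / (N * geom N c) * ∑ i, ∑ j, A i j := by
    simp only [wavg, couple, hA, Finset.mul_sum]
    refine Finset.sum_congr rfl fun i _ => ?_
    rw [← Equiv.sum_comp σ]
    refine Finset.sum_congr rfl fun j _ => ?_
    field_simp
  rw [heq]
  calc K / (N * geom N c) * ∑ i, ∑ j, A i j ≤ K / (N * geom N c) * -(k * psiL ψ * diam x) := by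
        gcongr
    _ = _ := by ring

theorem IsSymmConnected.wdiff_couple_le [NeZero N] (hψ : IsSymmConnected ψ) {c k K : ℝ}
    (hc : 1 ≤ c) (hk : 0 ≤ k) (hK : 0 ≤ K) {φ : Fin N → Fin N → ℝ} {x : Fin N → ℝ}
    (h1 : ∀ p q, x q ≤ x p → φ p q ≤ 0 ∧ 0 ≤ φ q p)
    (h2 : ∀ p q, x q ≤ x p → c * φ p q + φ q p ≤ -k * (x p - x q) ∧
      k * (x p - x q) ≤ c * φ q p + φ p q)
    {σ τ : Equiv.Perm (Fin N)} (hσ : Monotone (x ∘ σ)) (hτ : Monotone ((-x) ∘ τ)) :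
    wdiff c σ τ (couple ψ K φ) ≤ -(2 * K * psiL ψ * k / (N * geom N c)) * diam x := by
  have e1 := hψ.wavg_couple_le hc hk hK (fun p q h => (h1 p q h).1) (fun p q h => (h2 p q h).1) hσ
  have e2 := hψ.wavg_couple_le hc hk hK (φ := fun p q => -φ p q) (x := -x)
    (fun p q h => by linarith [(h1 q p (neg_le_neg_iff.1 h)).2])
    (fun p q h => by
      have := (h2 q p (neg_le_neg_iff.1 h)).2
      simp only [Pi.neg_apply]
      linarith) hτ
  have e3 : couple ψ K (fun p q => -φ p q) = -couple ψ K φ := by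
    ext i
    simp [couple]
  have e4 : diam x ≤ diam (-x) := by simpa using diam_neg_le (-x)
  rw [e3] at e2
  have hN : (0 : ℝ) < N := Nat.cast_pos.2 (NeZero.pos N)
  have hS : 0 < geom N c := one_pos.trans_le (one_le_geom (by linarith))
  have h0 : 0 ≤ K * psiL ψ * k / (N * geom N c) := by
    have := psiL_nonneg (ψ := ψ)
    positivity
  have e5 := mul_le_mul_of_nonneg_left e4 h0
  have e6 : 2 * K * psiL ψ * k / (N * geom N c) = 2 * (K * psiL ψ * k / (N * geom N c)) := by ring
  rw [wdiff, e6]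
  linarith

/-- Concavity of the sine: its graph lies above the chord from `0` to `γ`. -/
theorem sin_div_mul_le_sin {γ d : ℝ} (hγ : 0 < γ) (hγ' : γ ≤ π) (hd : 0 ≤ d) (hd' : d ≤ γ) :
    sin γ / γ * d ≤ sin d := by
  have h := strictConcaveOn_sin_Icc.concaveOn.2 (show (0 : ℝ) ∈ Icc 0 π from ⟨le_rfl, pi_pos.le⟩)
    (show γ ∈ Icc 0 π from ⟨hγ.le, hγ'⟩) (sub_nonneg.2 ((div_le_one hγ).2 hd'))
    (div_nonneg hd hγ.le) (sub_add_cancel 1 (d / γ))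
  simp only [smul_eq_mul, sin_zero, mul_zero, zero_add] at h
  rw [div_mul_cancel₀ _ hγ.ne'] at h
  calc sin γ / γ * d = d / γ * sin γ := by ring
    _ ≤ _ := h

theorem IsSymmConnected.wdiff_couple_sin_le [NeZero N] (hψ : IsSymmConnected ψ) {c K γ : ℝ}
    (hc : 2 ≤ c) (hK : 0 ≤ K) (hγ : 0 < γ) (hγ' : γ ≤ π) {x : Fin N → ℝ} (hx : diam x ≤ γ)
    {σ τ : Equiv.Perm (Fin N)} (hσ : Monotone (x ∘ σ)) (hτ : Monotone ((-x) ∘ τ)) :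
    wdiff c σ τ (couple ψ K fun i j => sin (x j - x i)) ≤
      -(2 * K * psiL ψ * (sin γ / γ) / (N * geom N c)) * diam x := by
  have hs : ∀ p q, x q ≤ x p → sin γ / γ * (x p - x q) ≤ sin (x p - x q) := fun p q h =>
    sin_div_mul_le_sin hγ hγ' (sub_nonneg.2 h) ((sub_le_diam x p q).trans hx)
  have hk : 0 ≤ sin γ / γ := div_nonneg (sin_nonneg_of_nonneg_of_le_pi hγ.le hγ') hγ.le
  have hpos : ∀ p q, x q ≤ x p → 0 ≤ sin (x p - x q) := fun p q h =>
    (mul_nonneg hk (sub_nonneg.2 h)).trans (hs p q h)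
  have hanti : ∀ p q, sin (x q - x p) = -sin (x p - x q) := fun p q => by
    rw [← sin_neg, neg_sub]
  refine hψ.wdiff_couple_le (by linarith) hk hK (fun p q h => ?_) (fun p q h => ?_) hσ hτ
  · rw [hanti p q]
    exact ⟨by linarith [hpos p q h], hpos p q h⟩
  · rw [hanti p q]
    have h1 := hs p q h
    have h2 := mul_le_mul_of_nonneg_right hc (hpos p q h)
    constructor <;> linarith

theorem IsSymmConnected.wdiff_couple_cos_le [NeZero N] (hψ : IsSymmConnected ψ) {c K : ℝ}
    (hc : 1 ≤ c) (hK : 0 ≤ K) {C : Fin N → Fin N → ℝ} {x : Fin N → ℝ}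
    (hC : ∀ i j, 2 ≤ c * C i j) (hC' : ∀ i j, C i j ≤ 1)
    {σ τ : Equiv.Perm (Fin N)} (hσ : Monotone (x ∘ σ)) (hτ : Monotone ((-x) ∘ τ)) :
    wdiff c σ τ (couple ψ K fun i j => C i j * (x j - x i)) ≤
      -(2 * K * psiL ψ / (N * geom N c)) * diam x := by
  have hpos : ∀ i j, 0 ≤ C i j := fun i j => by
    by_contra h
    nlinarith [hC i j]
  -- `k = 1` because `c * C p q - C q p ≥ 2 - 1`, although `C` need not be symmetric.
  have := hψ.wdiff_couple_le (k := 1) hc zero_le_one hK (φ := fun i j => C i j * (x j - x i))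
    (x := x) (fun p q h => ⟨mul_nonpos_of_nonneg_of_nonpos (hpos p q) (by linarith),
      mul_nonneg (hpos q p) (by linarith)⟩) (fun p q h => ?_) hσ hτ
  · rwa [mul_one] at this
  · have h1 := mul_le_mul_of_nonneg_right (hC p q) (sub_nonneg.2 h)
    have h2 := mul_le_mul_of_nonneg_right (hC' p q) (sub_nonneg.2 h)
    have h3 := mul_le_mul_of_nonneg_right (hC q p) (sub_nonneg.2 h)
    have h4 := mul_le_mul_of_nonneg_right (hC' q p) (sub_nonneg.2 h)
    constructor <;> linarith

end Network

/-! ### First-order form of the flow and the energy inequalities. -/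

section Dynamics

variable {N : ℕ} {ψ : Fin N → Fin N → ℝ} {Ω : Fin N → ℝ} {m K α : ℝ}

/-- The total force `Ω_i + (K / N) ∑_j ψ_{ij} sin (x_j - x_i + α)` at the phases `x`. -/
noncomputable def force (ψ : Fin N → Fin N → ℝ) (Ω : Fin N → ℝ) (K α : ℝ) (x : Fin N → ℝ) :
    Fin N → ℝ :=
  Ω + couple ψ K fun i j => sin (x j - x i + α)

/-- The derivative of the force at the phases `x` in the direction `y`. -/
noncomputable def lin (ψ : Fin N → Fin N → ℝ) (K α : ℝ) (x y : Fin N → ℝ) : Fin N → ℝ :=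
  couple ψ K fun i j => cos (x j - x i + α) * (y j - y i)

/-- The second derivative of the force at the phases `x` in the direction `y`, up to sign. -/
noncomputable def quad (ψ : Fin N → Fin N → ℝ) (K α : ℝ) (x y : Fin N → ℝ) : Fin N → ℝ :=
  couple ψ K fun i j => sin (x j - x i + α) * (y j - y i) ^ 2

/-- The acceleration at the phases `x` and frequencies `y`. -/
noncomputable def accel (ψ : Fin N → Fin N → ℝ) (Ω : Fin N → ℝ) (m K α : ℝ) (x y : Fin N → ℝ) :
    Fin N → ℝ :=
  m⁻¹ • (force ψ Ω K α x - y)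

/-- The jerk at the phases `x` and frequencies `y`. -/
noncomputable def jerk (ψ : Fin N → Fin N → ℝ) (Ω : Fin N → ℝ) (m K α : ℝ) (x y : Fin N → ℝ) :
    Fin N → ℝ :=
  m⁻¹ • (lin ψ K α x y - accel ψ Ω m K α x y)

theorem continuous_force : Continuous (force ψ Ω K α) := by
  unfold force couple
  fun_prop

theorem continuous_lin : Continuous fun p : (Fin N → ℝ) × (Fin N → ℝ) => lin ψ K α p.1 p.2 := by
  unfold lin couple
  fun_prop

theorem continuous_accel :
    Continuous fun p : (Fin N → ℝ) × (Fin N → ℝ) => accel ψ Ω m K α p.1 p.2 := by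
  unfold accel
  exact (((continuous_force (ψ := ψ) (Ω := Ω) (K := K) (α := α)).comp continuous_fst).sub
    continuous_snd).const_smul m⁻¹

theorem continuous_jerk :
    Continuous fun p : (Fin N → ℝ) × (Fin N → ℝ) => jerk ψ Ω m K α p.1 p.2 := by
  unfold jerk
  exact ((continuous_lin (ψ := ψ) (K := K) (α := α)).sub continuous_accel).const_smul m⁻¹

theorem hasDerivAt_force {x : ℝ → Fin N → ℝ} {y : Fin N → ℝ} {t : ℝ}
    (hx : ∀ i, HasDerivAt (fun s => x s i) (y i) t) (i : Fin N) :
    HasDerivAt (fun s => force ψ Ω K α (x s) i) (lin ψ K α (x t) y i) t := by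
  unfold force lin couple
  refine HasDerivAt.const_add _ (HasDerivAt.const_mul _ (HasDerivAt.fun_sum fun j _ => ?_))
  exact ((((hx j).sub (hx i)).add_const α).sin).const_mul _

theorem hasDerivAt_lin {x y : ℝ → Fin N → ℝ} {z : Fin N → ℝ} {t : ℝ}
    (hx : ∀ i, HasDerivAt (fun s => x s i) (y t i) t)
    (hy : ∀ i, HasDerivAt (fun s => y s i) (z i) t) (i : Fin N) :
    HasDerivAt (fun s => lin ψ K α (x s) (y s) i)
      (lin ψ K α (x t) z i - quad ψ K α (x t) (y t) i) t := by
  unfold lin quad couple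
  rw [← mul_sub, ← Finset.sum_sub_distrib]
  refine HasDerivAt.const_mul _ (HasDerivAt.fun_sum fun j _ => ?_)
  convert! (((((hx j).sub (hx i)).add_const α).cos).mul ((hy j).sub (hy i))).const_mul (ψ i j)
    using 1
  simp only [Pi.sub_apply]
  ring

theorem IsSymmConnected.diam_lin_le [NeZero N] (hψ : IsSymmConnected ψ) (hK : 0 ≤ K)
    (x y : Fin N → ℝ) : diam (lin ψ K α x y) ≤ 2 * (K * psiU ψ * diam y) := by
  refine hψ.diam_couple_le hK fun i j => ?_
  rw [abs_mul]
  exact (mul_le_of_le_one_left (abs_nonneg _) (abs_cos_le_one _)).trans (abs_sub_le_diam y j i)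

theorem IsSymmConnected.diam_quad_le [NeZero N] (hψ : IsSymmConnected ψ) (hK : 0 ≤ K)
    (x y : Fin N → ℝ) : diam (quad ψ K α x y) ≤ 2 * (K * psiU ψ * diam y ^ 2) := by
  refine hψ.diam_couple_le hK fun i j => ?_
  rw [abs_mul, abs_pow]
  exact (mul_le_of_le_one_left (by positivity) (abs_sin_le_one _)).trans
    (pow_le_pow_left₀ (abs_nonneg _) (abs_sub_le_diam y j i) 2)

/-- Separates the attractive odd part of the coupling from the frustration, which has size `sin α`
and is treated as a bounded disturbance. -/
theorem force_eq (x : Fin N → ℝ) : force ψ Ω K α x =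
    Ω + sin α • couple ψ K (fun i j => cos (x j - x i)) +
      cos α • couple ψ K fun i j => sin (x j - x i) := by
  ext i
  simp only [force, couple, Pi.add_apply, Pi.smul_apply, smul_eq_mul, sin_add, mul_add,
    Finset.sum_add_distrib, Finset.mul_sum]
  rw [add_assoc]
  congr 1
  rw [add_comm]
  congr 1 <;> exact Finset.sum_congr rfl fun j _ => by ring

theorem diam_add_le [NeZero N] (y z : Fin N → ℝ) : diam (y + z) ≤ diam y + diam z :=
  diam_le fun i j => by
    simp only [Pi.add_apply]
    linarith [sub_le_diam y i j, sub_le_diam z i j]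

theorem diam_smul_le [NeZero N] {k : ℝ} (hk : 0 ≤ k) (z : Fin N → ℝ) :
    diam (k • z) ≤ k * diam z :=
  diam_le fun i j => by
    simp only [Pi.smul_apply, smul_eq_mul, ← mul_sub]
    exact mul_le_mul_of_nonneg_left (sub_le_diam z i j) hk

theorem IsSymmConnected.diam_force_le [NeZero N] (hψ : IsSymmConnected ψ) (hK : 0 ≤ K)
    (hs : 0 ≤ sin α) (hc : 0 ≤ cos α) (x : Fin N → ℝ) :
    diam (force ψ Ω K α x) ≤
      diam Ω + 2 * K * psiU ψ * sin α + 2 * K * psiU ψ * cos α * diam x := by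
  have h1 : diam (couple ψ K fun i j => cos (x j - x i)) ≤ 2 * (K * psiU ψ * 1) :=
    hψ.diam_couple_le hK fun i j => abs_cos_le_one _
  have h2 : diam (couple ψ K fun i j => sin (x j - x i)) ≤ 2 * (K * psiU ψ * diam x) :=
    hψ.diam_couple_le hK fun i j => abs_sin_le_abs.trans (abs_sub_le_diam x j i)
  rw [force_eq]
  refine (diam_add_le _ _).trans ((add_le_add (diam_add_le _ _) (diam_smul_le hc _)).trans ?_)
  have h3 := (diam_smul_le hs _).trans (mul_le_mul_of_nonneg_left h1 hs)
  have h4 := mul_le_mul_of_nonneg_left h2 hc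
  linarith

theorem accel_spec (hm : m ≠ 0) (x y : Fin N → ℝ) :
    y = force ψ Ω K α x + (-m) • accel ψ Ω m K α x y := by
  rw [accel, smul_smul, neg_mul, mul_inv_cancel₀ hm]
  module

theorem jerk_spec (hm : m ≠ 0) (x y : Fin N → ℝ) :
    accel ψ Ω m K α x y = lin ψ K α x y + (-m) • jerk ψ Ω m K α x y := by
  rw [jerk, smul_smul, neg_mul, mul_inv_cancel₀ hm]
  module

/-- Accelerations and jerks both solve `m z' = u - z`; this is their common damping estimate. -/
theorem upperDini_combDiff_relax [NeZero N] {c : ℝ} (hc : 1 < c) (hm : 0 < m)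
    {z : ℝ → Fin N → ℝ} {u : Fin N → ℝ} {t : ℝ}
    (hz : ∀ i, HasDerivAt (fun s => z s i) ((m⁻¹ • (u - z t)) i) t) :
    UpperDini (fun s => combDiff c (z s)) t (m⁻¹ * (diam u - combDiff c (z t))) := by
  refine upperDini_combDiff hz fun σ τ hσ hτ => ?_
  rw [wdiff_smul, sub_eq_add_neg, ← neg_one_smul ℝ (z t), wdiff_add, wdiff_smul,
    wdiff_eq_of_monotone hσ hτ]
  have := (wdiff_le hc σ τ u).trans (combDiff_le_diam (by linarith) u)
  gcongr
  linarith

/-- The state of a solution on `t > 0` in first-order form. -/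
structure IsFlow (ψ : Fin N → Fin N → ℝ) (Ω : Fin N → ℝ) (m K α : ℝ)
    (θ ω : ℝ → Fin N → ℝ) : Prop where
  phase : ∀ t, 0 < t → ∀ i, HasDerivAt (fun s => θ s i) (ω t i) t
  freq : ∀ t, 0 < t → ∀ i, HasDerivAt (fun s => ω s i) (accel ψ Ω m K α (θ t) (ω t) i) t

variable {θ ω : ℝ → Fin N → ℝ}

theorem IsSolution.isFlow (hm : m ≠ 0) (h : IsSolution ψ Ω m K α θ ω) :
    IsFlow ψ Ω m K α θ ω := by
  refine ⟨h.hasDerivAt_phase, fun t ht i => ?_⟩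
  have e : accel ψ Ω m K α (θ t) (ω t) i = deriv (fun s => ω s i) t := by
    have := h.equation t ht i
    simp only [accel, force, couple, Pi.smul_apply, Pi.sub_apply, Pi.add_apply, smul_eq_mul]
    rw [← this]
    field_simp
    ring
  rw [e]
  exact (h.differentiableAt_freq t ht i).hasDerivAt

namespace IsFlow

theorem hasDerivAt_accel (h : IsFlow ψ Ω m K α θ ω) {t : ℝ} (ht : 0 < t) (i : Fin N) :
    HasDerivAt (fun s => accel ψ Ω m K α (θ s) (ω s) i) (jerk ψ Ω m K α (θ t) (ω t) i) t := by
  have := ((hasDerivAt_force (ψ := ψ) (Ω := Ω) (K := K) (α := α) (h.phase t ht) i).sub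
    (h.freq t ht i)).const_mul m⁻¹
  exact this

theorem hasDerivAt_jerk (h : IsFlow ψ Ω m K α θ ω) {t : ℝ} (ht : 0 < t) (i : Fin N) :
    HasDerivAt (fun s => jerk ψ Ω m K α (θ s) (ω s) i)
      ((m⁻¹ • (lin ψ K α (θ t) (accel ψ Ω m K α (θ t) (ω t)) - quad ψ K α (θ t) (ω t) -
        jerk ψ Ω m K α (θ t) (ω t))) i) t := by
  have := ((hasDerivAt_lin (ψ := ψ) (K := K) (α := α) (h.phase t ht) (h.freq t ht) i).sub
    (h.hasDerivAt_accel ht i)).const_mul m⁻¹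
  exact this

theorem dot_eq (h : IsFlow ψ Ω m K α θ ω) {t : ℝ} (ht : 0 < t) :
    dot ω t = accel ψ Ω m K α (θ t) (ω t) := by
  ext i
  rw [dot, derivWithin_of_mem_nhds (Ici_mem_nhds ht)]
  exact (h.freq t ht i).deriv

theorem dot_dot_eq (h : IsFlow ψ Ω m K α θ ω) {t : ℝ} (ht : 0 < t) :
    dot (dot ω) t = jerk ψ Ω m K α (θ t) (ω t) := by
  ext i
  rw [dot, derivWithin_of_mem_nhds (Ici_mem_nhds ht)]
  have he : (fun s => dot ω s i) =ᶠ[𝓝 t] fun s => accel ψ Ω m K α (θ s) (ω s) i := by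
    filter_upwards [Ioi_mem_nhds ht] with s hs
    rw [h.dot_eq hs]
  rw [he.deriv_eq]
  exact (h.hasDerivAt_accel ht i).deriv

end IsFlow

theorem upperDini_combDiff_phase [NeZero N] (hψ : IsSymmConnected ψ) {c γ t : ℝ}
    (hm : 0 < m) (hK : 0 ≤ K) (hs : 0 ≤ sin α) (hcos : 0 ≤ cos α) (hc : 2 < c) (hγ : 0 < γ)
    (hγ' : γ ≤ π) (h : IsFlow ψ Ω m K α θ ω) (ht : 0 < t) (hD : diam (θ t) ≤ γ) :
    UpperDini (fun s => combDiff c (θ s)) t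
      (diam Ω + 2 * K * psiU ψ * sin α -
        2 * K * psiL ψ * cos α * sin γ / (N * geom N c * γ) * diam (θ t) +
        m * combDiff c (accel ψ Ω m K α (θ t) (ω t))) := by
  refine upperDini_combDiff (h.phase t ht) fun σ τ hσ hτ => ?_
  have hc1 : 1 < c := by linarith
  have hc0 : 0 < c := by linarith
  have hω := congrArg (wdiff c σ τ)
    (accel_spec (ψ := ψ) (Ω := Ω) (K := K) (α := α) hm.ne' (θ t) (ω t))
  simp only [force_eq, wdiff_add, wdiff_smul] at hω
  have h1 := (wdiff_le hc1 σ τ Ω).trans (combDiff_le_diam hc0 Ω)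
  have h2 := (wdiff_le hc1 σ τ (couple ψ K fun i j => cos (θ t j - θ t i))).trans
    ((combDiff_le_diam hc0 _).trans
      (hψ.diam_couple_le (M := 1) hK fun i j => abs_cos_le_one _))
  have h3 := hψ.wdiff_couple_sin_le hc.le hK hγ hγ' hD hσ hτ
  have h4 := neg_combDiff_le_wdiff hc1 σ τ (accel ψ Ω m K α (θ t) (ω t))
  have h5 := mul_le_mul_of_nonneg_left h2 hs
  have h6 := mul_le_mul_of_nonneg_left h3 hcos
  have h7 := mul_le_mul_of_nonneg_left h4 hm.le
  have e : 2 * K * psiL ψ * cos α * sin γ / (N * geom N c * γ) =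
      cos α * (2 * K * psiL ψ * (sin γ / γ) / (N * geom N c)) := by
    have hN : (0 : ℝ) < N := Nat.cast_pos.2 (NeZero.pos N)
    have hS : 0 < geom N c := one_pos.trans_le (one_le_geom hc0.le)
    field_simp
  rw [e, hω]
  linarith

theorem IsSymmConnected.diam_freq_le [NeZero N] (hψ : IsSymmConnected ψ) (hm : 0 < m) (hK : 0 ≤ K)
    (hs : 0 ≤ sin α) (hc : 0 ≤ cos α) (x y : Fin N → ℝ) :
    diam y ≤ diam Ω + 2 * K * psiU ψ * sin α + 2 * K * psiU ψ * cos α * diam x +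
      m * diam (accel ψ Ω m K α x y) := by
  conv_lhs => rw [accel_spec (ψ := ψ) (Ω := Ω) (K := K) (α := α) hm.ne' x y]
  refine (diam_add_le _ _).trans (add_le_add (hψ.diam_force_le hK hs hc x) ?_)
  rw [neg_smul]
  exact (diam_neg_le _).trans (diam_smul_le hm.le _)

/-- The energy controlling the phase diameter. -/
noncomputable def energyPhase (ψ : Fin N → Fin N → ℝ) (Ω : Fin N → ℝ) (m K α c : ℝ)
    (x y : Fin N → ℝ) : ℝ :=
  combDiff c x + 2 * m ^ 2 * combDiff c (accel ψ Ω m K α x y)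

/-- The acceleration part supplies `-2 m A`, against the error `m A` from the phases. Its input is
at most `(G + ρ * Dθ + m * A) / 4` by `b1` and `b2`. What remains is `5/4 * G - 3/4 * ρ * Dθ - 3/4 *
m * A`, and `b3` makes the last term dominate the acceleration part of the energy. -/
theorem upperDini_energyPhase [NeZero N] (hψ : IsSymmConnected ψ) {c γ t ρ G : ℝ}
    (hm : 0 < m) (hK : 0 ≤ K) (hs : 0 ≤ sin α) (hcos : 0 ≤ cos α) (hc : 2 < c) (hγ : 0 < γ)
    (hγ' : γ ≤ π) (h : IsFlow ψ Ω m K α θ ω) (ht : 0 < t) (hD : diam (θ t) ≤ γ)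
    (hρ : ρ = 2 * K * psiL ψ * cos α * sin γ / (N * geom N c * γ)) (hρ0 : 0 ≤ ρ)
    (hG : G = diam Ω + 2 * K * psiU ψ * sin α)
    (hη1 : eta c ≤ 1) (b1 : 16 * (m * K * psiU ψ) ≤ eta c)
    (b2 : 8 * m * K ^ 2 * psiU ψ ^ 2 * cos α ≤ ρ / 4) (b3 : ρ * m ≤ 1 / 2) :
    UpperDini (fun s => energyPhase ψ Ω m K α c (θ s) (ω s)) t
      (5 / 4 * G - 3 / 4 * ρ * energyPhase ψ Ω m K α c (θ t) (ω t)) := by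
  have hc1 : 1 < c := by linarith
  have hc0 : 0 < c := by linarith
  set A := combDiff c (accel ψ Ω m K α (θ t) (ω t)) with hA
  have hA0 : 0 ≤ A := combDiff_nonneg hc1 _
  have d1 := upperDini_combDiff_phase hψ hm hK hs hcos hc hγ hγ' h ht hD
  have d2 := upperDini_combDiff_relax hc1 hm (h.hasDerivAt_accel ht)
  refine (d1.add (d2.const_mul (k := 2 * m ^ 2) (by positivity))).mono ?_
  rw [← hρ, ← hG, energyPhase, ← hA]
  have hU : 0 ≤ psiU ψ := psiU_nonneg
  have e1 := hψ.diam_lin_le (α := α) hK (θ t) (ω t)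
  have e2 := hψ.diam_freq_le (Ω := Ω) hm hK hs hcos (θ t) (ω t)
  have e3 : eta c * diam (accel ψ Ω m K α (θ t) (ω t)) ≤ A := eta_mul_diam_le hc1 _
  have e4 : combDiff c (θ t) ≤ diam (θ t) := combDiff_le_diam hc0 _
  rw [← hG] at e2
  set Da := diam (accel ψ Ω m K α (θ t) (ω t))
  set Dθ := diam (θ t)
  have hDa : 0 ≤ Da := diam_nonneg _
  have hDθ : 0 ≤ Dθ := diam_nonneg _
  have hG0 : 0 ≤ G := by
    rw [hG]
    have := diam_nonneg Ω
    positivity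
  have f1 : 2 * m ^ 2 * (m⁻¹ * (diam (lin ψ K α (θ t) (ω t)) - A)) =
      2 * m * (diam (lin ψ K α (θ t) (ω t)) - A) := by field_simp
  rw [f1]
  have f2 : 2 * m * diam (lin ψ K α (θ t) (ω t)) ≤
      4 * (m * K * psiU ψ) * (G + 2 * K * psiU ψ * cos α * Dθ + m * Da) := by
    have := mul_le_mul_of_nonneg_left (e1.trans (mul_le_mul_of_nonneg_left
      (mul_le_mul_of_nonneg_left e2 (mul_nonneg hK hU)) zero_le_two)) (by positivity : 0 ≤ 2 * m)
    linarith
  have f3 : 4 * (m * K * psiU ψ) * G ≤ 1 / 4 * G :=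
    mul_le_mul_of_nonneg_right (by linarith) hG0
  have f4 : 4 * (m * K * psiU ψ) * (2 * K * psiU ψ * cos α * Dθ) ≤ ρ / 4 * Dθ := by
    have := mul_le_mul_of_nonneg_right b2 hDθ
    linarith
  have f5 : 4 * (m * K * psiU ψ) * (m * Da) ≤ 1 / 4 * m * A := by
    have g1 := mul_le_mul_of_nonneg_right b1 (mul_nonneg hm.le hDa)
    have g2 := mul_le_mul_of_nonneg_left e3 hm.le
    linarith
  have f6 := mul_le_mul_of_nonneg_left e4 hρ0
  have f7 := mul_le_mul_of_nonneg_right b3 (mul_nonneg hm.le hA0)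
  linarith

/-- The second-order energy as a function of the phases and frequencies. -/
noncomputable def energyFreq (ψ : Fin N → Fin N → ℝ) (Ω : Fin N → ℝ) (m K α c : ℝ)
    (x y : Fin N → ℝ) : ℝ :=
  combDiff c y +
    eta c * psiL ψ / (2 * N * psiU ψ * geom N c) * m * combDiff c (accel ψ Ω m K α x y) +
    2 * m ^ 2 * combDiff c (jerk ψ Ω m K α x y)

/-- With `Λ = rate ψ K c`, the coupling yields `-4 Λ Dω`. The input to the accelerations costs `2 Λ
Dω`, which fixes the size of `κ`, and the quadratic term costs `q Λ Dω`. There remain `-(2 - q) Λ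
Dω`, `-κ/2 * A` and `-m B`. Thus `q` measures how small the frequency diameter already is and
determines the available rate `r`. -/
theorem upperDini_energyFreq [NeZero N] (hψ : IsSymmConnected ψ) {c t q r : ℝ}
    (hm : 0 < m) (hK : 0 < K) (hc : 2 < c) (h : IsFlow ψ Ω m K α θ ω) (ht : 0 < t)
    (hcos : ∀ i j, 2 ≤ c * cos (θ t j - θ t i + α)) (hL : 0 < psiL ψ)
    (hη : 0 < eta c) (hη1 : eta c ≤ 1)
    (b1 : 16 * (m * K * psiU ψ) ≤ eta c ^ 2 * psiL ψ / (N * psiU ψ * geom N c))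
    (b2 : rate ψ K c * m ≤ 1 / 4) (b3 : 4 * (m * K * psiU ψ) * diam (ω t) ≤ q * rate ψ K c)
    (hr0 : 0 ≤ r) (hr1 : r ≤ rate ψ K c) (hr2 : r ≤ (2 - q) * rate ψ K c) :
    UpperDini (fun s => energyFreq ψ Ω m K α c (θ s) (ω s)) t
      (0 - r * energyFreq ψ Ω m K α c (θ t) (ω t)) := by
  have hc1 : 1 < c := by linarith
  have hc0 : 0 < c := by linarith
  have hN : (0 : ℝ) < N := Nat.cast_pos.2 (NeZero.pos N)
  have hS : 0 < geom N c := one_pos.trans_le (one_le_geom hc0.le)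
  have hU : 0 < psiU ψ := hL.trans_le psiL_le_psiU
  set κ := eta c * psiL ψ / (2 * N * psiU ψ * geom N c) with hκ
  have hκ0 : 0 < κ := by positivity
  set A := combDiff c (accel ψ Ω m K α (θ t) (ω t)) with hA
  set B := combDiff c (jerk ψ Ω m K α (θ t) (ω t)) with hB
  set Da := diam (accel ψ Ω m K α (θ t) (ω t)) with hDa
  set Dω := diam (ω t) with hDω
  have hA0 : 0 ≤ A := combDiff_nonneg hc1 _
  have hB0 : 0 ≤ B := combDiff_nonneg hc1 _
  have hDω0 : 0 ≤ Dω := diam_nonneg _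
  have d1 : UpperDini (fun s => combDiff c (ω s)) t (-(4 * rate ψ K c) * Dω + m * B) := by
    refine upperDini_combDiff (h.freq t ht) fun σ τ hσ hτ => ?_
    rw [jerk_spec hm.ne', wdiff_add, wdiff_smul]
    have h1 := hψ.wdiff_couple_cos_le hc1.le hK.le hcos (fun i j => cos_le_one _) hσ hτ
    have h2 := mul_le_mul_of_nonneg_left (neg_combDiff_le_wdiff hc1 σ τ
      (jerk ψ Ω m K α (θ t) (ω t))) hm.le
    have e : 2 * K * psiL ψ / (N * geom N c) = 4 * rate ψ K c := by
      rw [rate]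
      field_simp
      ring
    rw [e] at h1
    change wdiff c σ τ (lin ψ K α (θ t) (ω t)) ≤ _ at h1
    linarith
  have d2 := upperDini_combDiff_relax hc1 hm (h.hasDerivAt_accel ht)
  have d3 := upperDini_combDiff_relax hc1 hm (h.hasDerivAt_jerk ht)
  refine ((d1.add (d2.const_mul (k := κ * m) (by positivity))).add
    (d3.const_mul (k := 2 * m ^ 2) (by positivity))).mono ?_
  rw [energyFreq, ← hA, ← hB, ← hκ]
  have e1 := hψ.diam_lin_le (α := α) hK.le (θ t) (ω t)
  have e2 := hψ.diam_lin_le (α := α) hK.le (θ t) (accel ψ Ω m K α (θ t) (ω t))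
  have e3 := hψ.diam_quad_le (α := α) hK.le (θ t) (ω t)
  have e4 : eta c * Da ≤ A := eta_mul_diam_le hc1 _
  have e5 : combDiff c (ω t) ≤ Dω := combDiff_le_diam hc0 _
  have e6 : diam (lin ψ K α (θ t) (accel ψ Ω m K α (θ t) (ω t)) - quad ψ K α (θ t) (ω t)) ≤
      2 * (K * psiU ψ * Da) + 2 * (K * psiU ψ * Dω ^ 2) := by
    rw [sub_eq_add_neg]
    exact (diam_add_le _ _).trans (add_le_add e2 ((diam_neg_le _).trans e3))
  have f1 : κ * m * (m⁻¹ * (diam (lin ψ K α (θ t) (ω t)) - A)) =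
      κ * (diam (lin ψ K α (θ t) (ω t)) - A) := by field_simp
  have f2 : ∀ z : ℝ, 2 * m ^ 2 * (m⁻¹ * (z - B)) = 2 * m * (z - B) := fun z => by field_simp
  rw [f1, f2]
  have g1 : κ * diam (lin ψ K α (θ t) (ω t)) ≤ 2 * rate ψ K c * Dω := by
    have k1 := mul_le_mul_of_nonneg_left e1 hκ0.le
    have k2 : κ * (2 * (K * psiU ψ * diam (ω t))) = eta c * (2 * rate ψ K c * Dω) := by
      rw [hκ, rate, hDω]
      field_simp
    have k3 : 0 ≤ 2 * rate ψ K c * Dω := by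
      rw [rate]
      positivity
    exact k1.trans (k2.trans_le (mul_le_of_le_one_left k3 hη1))
  have g2 : 4 * (m * K * psiU ψ) * Da ≤ κ / 2 * A := by
    have k1 : 16 * (m * K * psiU ψ) ≤ eta c * (2 * κ) := by
      refine b1.trans_eq ?_
      rw [hκ]
      field_simp
    have k2 := mul_le_mul_of_nonneg_right k1 (diam_nonneg (accel ψ Ω m K α (θ t) (ω t)))
    have k3 := mul_le_mul_of_nonneg_left e4 hκ0.le
    linarith
  have g3 : 4 * (m * K * psiU ψ) * Dω ^ 2 ≤ q * rate ψ K c * Dω := by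
    have := mul_le_mul_of_nonneg_right b3 hDω0
    linarith
  have g4 := mul_le_mul_of_nonneg_left e6 (by positivity : 0 ≤ 2 * m)
  have g5 := mul_le_mul_of_nonneg_left e5 hr0
  have g6 : r * m ≤ 1 / 4 := (mul_le_mul_of_nonneg_right hr1 hm.le).trans b2
  have g7 := mul_le_mul_of_nonneg_right g6 (mul_nonneg hκ0.le hA0)
  have g8 := mul_le_mul_of_nonneg_right g6 (mul_nonneg hm.le hB0)
  have g9 := mul_le_mul_of_nonneg_right hr2 hDω0
  have g10 := mul_nonneg hm.le hB0
  have g11 := mul_nonneg hκ0.le hA0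
  linarith

end Dynamics

/-! ### Trapping of the phases and decay of the frequencies. -/

section LongTime

variable {N : ℕ} {ψ : Fin N → Fin N → ℝ} {Ω : Fin N → ℝ} {m K α : ℝ} {θ ω : ℝ → Fin N → ℝ}

theorem continuousOn_energyPhase [NeZero N] {c : ℝ} (hc : 1 < c) (hθ : ContinuousOn θ (Ici 0))
    (hω : ContinuousOn ω (Ici 0)) :
    ContinuousOn (fun t => energyPhase ψ Ω m K α c (θ t) (ω t)) (Ici 0) := by
  have h1 := (continuous_combDiff hc).comp_continuousOn hθ
  have h2 := ((continuous_combDiff hc).comp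
    (continuous_accel (ψ := ψ) (Ω := Ω) (m := m) (K := K) (α := α))).comp_continuousOn
      (hθ.prodMk hω)
  exact h1.add (h2.const_smul (2 * m ^ 2))

theorem continuousOn_energyFreq [NeZero N] {c : ℝ} (hc : 1 < c) (hθ : ContinuousOn θ (Ici 0))
    (hω : ContinuousOn ω (Ici 0)) :
    ContinuousOn (fun t => energyFreq ψ Ω m K α c (θ t) (ω t)) (Ici 0) := by
  have h1 := (continuous_combDiff hc).comp_continuousOn hω
  have h2 := ((continuous_combDiff hc).comp
    (continuous_accel (ψ := ψ) (Ω := Ω) (m := m) (K := K) (α := α))).comp_continuousOn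
      (hθ.prodMk hω)
  have h3 := ((continuous_combDiff hc).comp
    (continuous_jerk (ψ := ψ) (Ω := Ω) (m := m) (K := K) (α := α))).comp_continuousOn
      (hθ.prodMk hω)
  exact (h1.add (h2.const_smul
    (eta c * psiL ψ / (2 * N * psiU ψ * geom N c) * m))).add (h3.const_smul (2 * m ^ 2))

theorem eta_mul_diam_le_energyPhase [NeZero N] {c : ℝ} (hc : 1 < c) (x y : Fin N → ℝ) :
    eta c * diam x ≤ energyPhase ψ Ω m K α c x y := by
  have := combDiff_nonneg hc (accel ψ Ω m K α x y)
  have h2 := eta_mul_diam_le hc x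
  rw [energyPhase]
  nlinarith [mul_nonneg (sq_nonneg m) this]

theorem energyPhase_le [NeZero N] (hψ : IsSymmConnected ψ) {c : ℝ} (hc : 1 < c) (hm : 0 < m)
    (hK : 0 ≤ K) (hs : 0 ≤ sin α) (hcos : 0 ≤ cos α) (x y : Fin N → ℝ) :
    energyPhase ψ Ω m K α c x y ≤ diam x + 2 * m * (diam Ω + 2 * K * psiU ψ * sin α +
      2 * K * psiU ψ * cos α * diam x + diam y) := by
  have hc0 : 0 < c := by linarith
  have h1 := combDiff_le_diam hc0 x
  have h2 := combDiff_le_diam hc0 (accel ψ Ω m K α x y)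
  have h3 : diam (accel ψ Ω m K α x y) ≤ m⁻¹ * (diam (force ψ Ω K α x) + diam y) := by
    refine (diam_smul_le (inv_nonneg.2 hm.le) _).trans ?_
    rw [sub_eq_add_neg]
    exact mul_le_mul_of_nonneg_left
      ((diam_add_le _ _).trans (add_le_add_right (diam_neg_le y) _)) (inv_nonneg.2 hm.le)
  have h4 := hψ.diam_force_le (Ω := Ω) hK hs hcos x
  have h5 := mul_le_mul_of_nonneg_left (h2.trans h3) (by positivity : 0 ≤ 2 * m ^ 2)
  have e : 2 * m ^ 2 * (m⁻¹ * (diam (force ψ Ω K α x) + diam y)) =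
      2 * m * (diam (force ψ Ω K α x) + diam y) := by field_simp
  have h6 := mul_le_mul_of_nonneg_left h4 (by positivity : 0 ≤ 2 * m)
  rw [energyPhase]
  linarith

theorem IsFlow.exists_diam_phase_le [NeZero N] (h : IsFlow ψ Ω m K α θ ω)
    (hθ : ContinuousOn θ (Ici 0)) (hω : ContinuousOn ω (Ici 0)) (hψ : IsSymmConnected ψ)
    {c β γ ρ G D : ℝ}
    (hm : 0 < m) (hK : 0 ≤ K) (hs : 0 ≤ sin α) (hcos : 0 ≤ cos α) (hc : 2 < c) (hγ : 0 < γ)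
    (hγ' : γ ≤ π) (hρ : ρ = 2 * K * psiL ψ * cos α * sin γ / (N * geom N c * γ)) (hρ0 : 0 < ρ)
    (hG : G = diam Ω + 2 * K * psiU ψ * sin α)
    (hη : 0 < eta c) (hη1 : eta c ≤ 1) (b1 : 16 * (m * K * psiU ψ) ≤ eta c)
    (b2 : 8 * m * K ^ 2 * psiU ψ ^ 2 * cos α ≤ ρ / 4) (b3 : ρ * m ≤ 1 / 2)
    (h0 : energyPhase ψ Ω m K α c (θ 0) (ω 0) < β) (hβ : β ≤ eta c * γ) (hDβ : D < β)
    (hD : 0 < D) (hGD : 5 / 3 * G < ρ * (eta c * D)) :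
    ∃ T, 0 < T ∧ ∀ t, T ≤ t → diam (θ t) ≤ D := by
  have hc1 : 1 < c := by linarith
  set E := fun t => energyPhase ψ Ω m K α c (θ t) (ω t) with hE
  have hcont : ContinuousOn E (Ici 0) := continuousOn_energyPhase hc1 hθ hω
  have hr : 0 < 3 / 4 * ρ := by positivity
  have hlev : 5 / 4 * G / (3 / 4 * ρ) < eta c * D := by
    rw [div_lt_iff₀ hr]
    linarith
  -- The equations hold only for positive times; continuity at `0` carries the strict initial bound
  -- to some `t₀ > 0`.
  obtain ⟨t₀, ht₀, ht₀E⟩ : ∃ t₀, 0 < t₀ ∧ E t₀ < β := by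
    have h1 : ContinuousWithinAt E (Ioi 0) 0 := (hcont 0 self_mem_Ici).mono Ioi_subset_Ici_self
    obtain ⟨t, ht, ht'⟩ := ((h1.eventually_lt_const h0).and self_mem_nhdsWithin).exists
    exact ⟨t, ht', ht⟩
  have hcont₀ : ContinuousOn E (Ici t₀) := hcont.mono (Ici_subset_Ici.2 ht₀.le)
  have hdini : ∀ t, t₀ ≤ t → E t ≤ β → UpperDini E t (5 / 4 * G - 3 / 4 * ρ * E t) := by
    intro t ht htE
    refine upperDini_energyPhase hψ hm hK hs hcos hc hγ hγ' h (ht₀.trans_le ht) ?_ hρ hρ0.le hG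
      hη1 b1 b2 b3
    have := (eta_mul_diam_le_energyPhase (ψ := ψ) (Ω := Ω) (m := m) (K := K) (α := α) hc1 (θ t)
      (ω t)).trans (htE.trans hβ)
    exact le_of_mul_le_mul_left this hη
  have hlevβ : 5 / 4 * G / (3 / 4 * ρ) < β :=
    hlev.trans ((mul_le_of_le_one_left hD.le hη1).trans_lt hDβ)
  -- The level `b` lies above the equilibrium value `5 G / (3 ρ)`, where the energy strictly
  -- decreases, and below `β`, where the phase diameter is still at most `γ`.
  obtain ⟨b, hb1, hb2⟩ := exists_between (max_lt ht₀E hlevβ)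
  have hb3 : 5 / 4 * G - 3 / 4 * ρ * b < 0 := by
    have := (div_lt_iff₀ hr).1 ((le_max_right _ _).trans_lt hb1)
    linarith
  have hbound : ∀ t, t₀ ≤ t → E t ≤ b :=
    le_of_upperDini_neg_at_level hcont₀ ((le_max_left _ _).trans hb1.le) hb3
      fun t ht htb => htb ▸ hdini t ht (htb.trans_le hb2.le)
  have hev := eventually_le_of_upperDini hr hcont₀
    (fun t ht => hdini t ht ((hbound t ht).trans hb2.le)) hlev
  obtain ⟨T, hT⟩ := eventually_atTop.1 hev
  refine ⟨max T t₀, lt_max_of_lt_right ht₀, fun t ht => ?_⟩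
  exact le_of_mul_le_mul_left ((eta_mul_diam_le_energyPhase hc1 (θ t) (ω t)).trans
    (hT t ((le_max_left _ _).trans ht))) hη

/-- Each difference `ω i - ω j` relaxes at rate `1/m` towards a difference of forces. -/
theorem IsFlow.eventually_diam_freq_le [NeZero N] (h : IsFlow ψ Ω m K α θ ω) (hm : 0 < m)
    {T F M : ℝ} (hT : 0 < T) (hF : ∀ t, T ≤ t → diam (force ψ Ω K α (θ t)) ≤ F) (hM : F < M) :
    ∀ᶠ t in atTop, diam (ω t) ≤ M := by
  have hm' : 0 < m⁻¹ := inv_pos.2 hm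
  have key : ∀ i j, ∀ᶠ t in atTop, ω t i - ω t j ≤ M := by
    intro i j
    have hd : ∀ t, T ≤ t → HasDerivAt (fun s => ω s i - ω s j) _ t := fun t ht =>
      (h.freq t (hT.trans_le ht) i).sub (h.freq t (hT.trans_le ht) j)
    refine eventually_le_of_upperDini (C := m⁻¹ * F) (r := m⁻¹) (T := T) hm'
      (fun t ht => (hd t ht).continuousAt.continuousWithinAt)
      (fun t ht => (hd t ht).upperDini.mono ?_) (by rwa [mul_div_cancel_left₀ _ hm'.ne'])
    have := mul_le_mul_of_nonneg_left ((sub_le_diam _ i j).trans (hF t ht)) hm'.le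
    simp only [accel, Pi.smul_apply, Pi.sub_apply, smul_eq_mul]
    linarith
  filter_upwards [eventually_all.2 fun i => eventually_all.2 (key i)] with t ht
  exact diam_le ht

theorem eta_mul_diam_le_energyFreq [NeZero N] {c : ℝ} (hc : 1 < c) (hη : 0 ≤ eta c) (hm : 0 ≤ m)
    (x y : Fin N → ℝ) : eta c * diam y ≤ energyFreq ψ Ω m K α c x y := by
  have h1 := combDiff_nonneg hc (accel ψ Ω m K α x y)
  have h2 := combDiff_nonneg hc (jerk ψ Ω m K α x y)
  have h3 := eta_mul_diam_le hc y
  have h4 : 0 < geom N c := one_pos.trans_le (one_le_geom (by linarith))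
  have h5 : 0 ≤ psiL ψ := psiL_nonneg
  have h6 : 0 ≤ psiU ψ := psiU_nonneg
  have h7 : 0 ≤ eta c * psiL ψ / (2 * N * psiU ψ * geom N c) * m *
    combDiff c (accel ψ Ω m K α x y) := by positivity
  have h8 : 0 ≤ 2 * m ^ 2 * combDiff c (jerk ψ Ω m K α x y) := by positivity
  rw [energyFreq]
  linarith

theorem IsFlow.exists_diam_freq_le_exp [NeZero N] (h : IsFlow ψ Ω m K α θ ω)
    (hθ : ContinuousOn θ (Ici 0)) (hω : ContinuousOn ω (Ici 0)) (hψ : IsSymmConnected ψ)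
    {c T : ℝ} (hm : 0 < m) (hK : 0 < K) (hc : 2 < c) (hT : 0 < T)
    (hcos : ∀ t, T ≤ t → ∀ i j, 2 ≤ c * cos (θ t j - θ t i + α)) (hL : 0 < psiL ψ)
    (hη : 0 < eta c) (hη1 : eta c ≤ 1) (hrate : 0 < rate ψ K c)
    (b1 : 16 * (m * K * psiU ψ) ≤ eta c ^ 2 * psiL ψ / (N * psiU ψ * geom N c))
    (b2 : rate ψ K c * m ≤ 1 / 4)
    (b3 : ∀ t, T ≤ t → 4 * (m * K * psiU ψ) * diam (ω t) ≤ 3 / 2 * rate ψ K c) :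
    ∃ tstar, 0 < tstar ∧ ∀ t, tstar ≤ t → diam (ω t) ≤
      energyFreq ψ Ω m K α c (θ tstar) (ω tstar) / eta c * exp (-rate ψ K c * (t - tstar)) := by
  have hc1 : 1 < c := by linarith
  have hU : 0 < psiU ψ := hL.trans_le psiL_le_psiU
  have hcont := continuousOn_energyFreq (ψ := ψ) (Ω := Ω) (m := m) (K := K) (α := α) hc1 hθ hω
  have hlow : ∀ t, eta c * diam (ω t) ≤ energyFreq ψ Ω m K α c (θ t) (ω t) := fun t =>
    eta_mul_diam_le_energyFreq hc1 hη.le hm.le _ _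
  have hp : 0 < 4 * (m * K * psiU ψ) := by positivity
  -- First pass, `q = 3/2`: decay at rate `Λ/2`. The target `M` is chosen so that afterwards `4 m K
  -- ψ_u Dω ≤ Λ`, which is the case `q = 1` needed for the full rate.
  have hev := eventually_le_of_upperDini (C := 0) (r := rate ψ K c / 2) (T := T)
    (M := eta c * (rate ψ K c / (4 * (m * K * psiU ψ)))) (half_pos hrate)
    (hcont.mono (Ici_subset_Ici.2 hT.le))
    (fun t ht => upperDini_energyFreq hψ hm hK hc h (hT.trans_le ht) (hcos t ht) hL hη hη1 b1 b2
      (b3 t ht) (half_pos hrate).le (by linarith) (by linarith))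
    (by rw [zero_div]; positivity)
  obtain ⟨T', hT'⟩ := eventually_atTop.1 hev
  have hTm : 0 < max T T' := lt_max_of_lt_left hT
  refine ⟨max T T', hTm, fun t ht => ?_⟩
  have hdecay := le_exp_of_upperDini (C := 0) hrate (hcont.mono (Ici_subset_Ici.2 hTm.le))
    (fun s hs => by
      have hTs : T ≤ s := (le_max_left _ _).trans hs
      refine upperDini_energyFreq (q := 1) hψ hm hK hc h (hT.trans_le hTs) (hcos s hTs) hL hη hη1
        b1 b2 ?_ hrate.le le_rfl (by linarith)
      have h1 := le_of_mul_le_mul_left ((hlow s).trans (hT' s ((le_max_right _ _).trans hs))) hη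
      rw [le_div_iff₀ hp] at h1
      linarith) t ht
  rw [zero_div, zero_add, sub_zero] at hdecay
  rw [div_mul_eq_mul_div, le_div_iff₀' hη]
  exact (hlow t).trans hdecay

end LongTime

/-! ### Consequences of the parameter conditions. -/

section Parameters

variable {N : ℕ} {ψ : Fin N → Fin N → ℝ} {Ω : Fin N → ℝ} {m K α β γ Dinf δ c : ℝ}

/-- If `psiL ψ` were `0`, the second bound on `m * K` would be a division by zero, which has value
`0`, contradicting `0 < m * K`. This also covers `N = 1`. -/
theorem H3.psiL_pos (hm : 0 < m) (hK : 0 < K) (h : H3 ψ Ω m K α γ Dinf c) : 0 < psiL ψ := by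
  refine lt_of_le_of_ne psiL_nonneg fun h0 => ?_
  have h1 := h.mK_lt.trans_le (min_le_right _ _)
  rw [← h0, mul_zero, div_zero] at h1
  exact absurd (mul_pos hm hK) h1.not_gt

theorem H2.cos_pos (hα : 0 < α) (h : H2 α β γ Dinf δ c) : 0 < cos (Dinf + δ) :=
  cos_pos_of_mem_Ioo ⟨by linarith [h.Dinf_pos, h.alpha_lt_delta, pi_pos], by linarith [h.delta_lt]⟩

theorem H2.two_lt_mul_cos (hα : 0 < α) (h : H2 α β γ Dinf δ c) : 2 < c * cos (Dinf + δ) :=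
  (div_lt_iff₀ (h.cos_pos hα)).1 ((le_max_left _ _).trans_lt h.lt_c)

theorem H2.two_lt_c (hα : 0 < α) (h : H2 α β γ Dinf δ c) : 2 < c := by
  have h1 := h.cos_pos hα
  have h2 := h.two_lt_mul_cos hα
  have h3 : 0 < c := pos_of_mul_pos_left (two_pos.trans h2) h1.le
  exact h2.trans_le (mul_le_of_le_one_right h3.le (cos_le_one _))

theorem eta_pos (hc : 2 < c) : 0 < eta c := by
  rw [eta, sub_pos, ← div_eq_mul_inv, div_lt_one (by linarith)]
  exact hc

theorem eta_le_one (hc : 0 < c) : eta c ≤ 1 := by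
  rw [eta]
  linarith [inv_pos.2 hc]

theorem H2.beta_le (hα : 0 < α) (hβ : 0 < β) (h : H2 α β γ Dinf δ c) : β ≤ eta c * γ := by
  have hγ : 0 < γ := hβ.trans h.beta_lt_gamma
  have h1 : 0 < 1 - β / γ := sub_pos.2 ((div_lt_one hγ).2 h.beta_lt_gamma)
  have h2 := (div_lt_iff₀ h1).1 ((le_max_right _ _).trans_lt h.lt_c)
  have hc : 0 < c := two_pos.trans (h.two_lt_c hα)
  have h3 : 2 * c⁻¹ < 1 - β / γ := by
    rwa [← div_eq_mul_inv, div_lt_iff₀' hc]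
  rw [← div_le_iff₀ hγ, eta]
  linarith

theorem H2.two_le_mul_cos (hα : 0 < α) (h : H2 α β γ Dinf δ c) {x : Fin N → ℝ}
    (hx : diam x ≤ Dinf) (i j : Fin N) : 2 ≤ c * cos (x j - x i + α) := by
  refine (h.two_lt_mul_cos hα).le.trans
    (mul_le_mul_of_nonneg_left ?_ (two_pos.trans (h.two_lt_c hα)).le)
  rw [← cos_abs (x j - x i + α)]
  refine cos_le_cos_of_nonneg_of_le_pi (abs_nonneg _) ?_ ?_
  · linarith [h.delta_lt, pi_pos]
  · have := abs_le.1 ((abs_sub_le_diam x j i).trans hx)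
    have := h.alpha_lt_delta
    exact abs_le.2 ⟨by linarith, by linarith⟩

end Parameters

end Kuramoto

/-! ### Choice of constants and conclusion. -/

theorem theorem1p1 {N : ℕ} [NeZero N] (ψ : Fin N → Fin N → ℝ) (Ω : Fin N → ℝ)
    (m K α β γ Dinf δ c : ℝ) (θ ω : ℝ → Fin N → ℝ)
    (hψ : Kuramoto.IsSymmConnected ψ)
    (hm : 0 < m) (hK : 0 < K) (hα : 0 < α) (hα' : α < π / 2) (hβ : 0 < β) (hβ' : β < π)
    (hsol : Kuramoto.IsSolution ψ Ω m K α θ ω)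
    (h1 : Kuramoto.H1 ψ Ω m K α β (θ 0) (ω 0))
    (h2 : Kuramoto.H2 α β γ Dinf δ c)
    (h3 : Kuramoto.H3 ψ Ω m K α γ Dinf c) :
    0 < Kuramoto.rate ψ K c ∧
    ∃ tstar : ℝ, 0 ≤ tstar ∧
      (∀ t, tstar ≤ t →
        Kuramoto.diam (ω t) ≤
          Kuramoto.energy₂ ψ m c ω tstar / Kuramoto.eta c *
            exp (-Kuramoto.rate ψ K c * (t - tstar))) ∧
      ∃ C : ℝ, 0 < C ∧ ∀ t, tstar ≤ t →
        Kuramoto.diam (ω t) ≤ C * exp (-Kuramoto.rate ψ K c * (t - tstar)) := by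
  open Kuramoto in
  have hflow := hsol.isFlow hm.ne'
  have hθ : ContinuousOn θ (Ici 0) := continuousOn_pi.2 hsol.continuousOn_phase
  have hω : ContinuousOn ω (Ici 0) := continuousOn_pi.2 hsol.continuousOn_freq
  have hs : 0 < sin α := sin_pos_of_pos_of_lt_pi hα (by linarith [pi_pos])
  have hcos : 0 < cos α := cos_pos_of_mem_Ioo ⟨by linarith, hα'⟩
  have hcos1 : cos α ≤ 1 := cos_le_one α
  have hc := h2.two_lt_c hα
  have hc0 : 0 < c := by linarith
  have hc1 : 1 < c := by linarith
  have hη := eta_pos hc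
  have hη1 := eta_le_one hc0
  have hγ : 0 < γ := hβ.trans h2.beta_lt_gamma
  have hγ' := h2.gamma_lt_pi
  have hsγ : 0 < sin γ := sin_pos_of_pos_of_lt_pi hγ hγ'
  have hsγ' : sin γ ≤ γ := sin_le hγ.le
  have hD := h2.Dinf_pos
  have hDβ : Dinf < β := h2.Dinf_lt.trans_le (min_le_right _ _)
  have hDγ : Dinf ≤ γ := (hDβ.trans h2.beta_lt_gamma).le
  have hL := h3.psiL_pos hm hK
  have hLU : psiL ψ ≤ psiU ψ := psiL_le_psiU
  have hU : 0 < psiU ψ := hL.trans_le hLU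
  have hN : (1 : ℝ) ≤ N := Nat.one_le_cast.2 (NeZero.one_le)
  have hS : 1 ≤ geom N c := one_le_geom hc0.le
  have hW : 1 ≤ N * geom N c := one_le_mul_of_one_le_of_one_le hN hS
  have hW0 : 0 < N * geom N c := one_pos.trans_le hW
  have hN0 : (0 : ℝ) < N := one_pos.trans_le hN
  have hS0 : 0 < geom N c := one_pos.trans_le hS
  have hrate : 0 < rate ψ K c := by
    rw [rate]
    positivity
  obtain ⟨G, hG⟩ : ∃ G, G = diam Ω + 2 * K * psiU ψ * sin α := ⟨_, rfl⟩
  have hG0 : 0 ≤ G := by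
    have := diam_nonneg Ω
    rw [hG]
    positivity
  have p1 : m * K * (16 * N * psiU ψ ^ 2 * geom N c * γ) < eta c ^ 2 * psiL ψ * sin γ :=
    (lt_div_iff₀ (by positivity)).1 (h3.mK_lt.trans_le (min_le_left _ _))
  have p2 : m * K * (2 * psiL ψ) < N * geom N c :=
    (lt_div_iff₀ (by positivity)).1 (h3.mK_lt.trans_le (min_le_right _ _))
  have p3 : 4 * G * N * geom N c * γ < K * (Dinf * eta c * psiL ψ * cos α * sin γ) := by
    rw [hG]
    exact (div_lt_iff₀ (by positivity)).1 h3.lt_K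
  have hη2 : eta c ^ 2 ≤ eta c := by nlinarith
  have q1 : 16 * (m * K * psiU ψ) ≤ eta c ^ 2 * psiL ψ / (N * psiU ψ * geom N c) := by
    rw [le_div_iff₀ (by positivity)]
    refine le_of_mul_le_mul_right ?_ hγ
    calc _ = m * K * (16 * N * psiU ψ ^ 2 * geom N c * γ) := by ring
      _ ≤ eta c ^ 2 * psiL ψ * sin γ := p1.le
      _ ≤ _ := by gcongr
  have q2 : 16 * (m * K * psiU ψ) ≤ eta c := by
    refine q1.trans ?_
    rw [div_le_iff₀ (by positivity)]
    calc eta c ^ 2 * psiL ψ ≤ eta c * psiU ψ := by gcongr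
      _ ≤ eta c * psiU ψ * (N * geom N c) := le_mul_of_one_le_right (by positivity) hW
      _ = _ := by ring
  have q3 : rate ψ K c * m ≤ 1 / 4 := by
    rw [rate, div_mul_eq_mul_div, div_le_iff₀ (by positivity)]
    linarith
  obtain ⟨ρ, hρ⟩ : ∃ ρ, ρ = 2 * K * psiL ψ * cos α * sin γ / (N * geom N c * γ) := ⟨_, rfl⟩
  have hρ0 : 0 < ρ := by
    rw [hρ]
    positivity
  have q4 : 8 * m * K ^ 2 * psiU ψ ^ 2 * cos α ≤ ρ / 4 := by
    rw [hρ, div_div, le_div_iff₀ (by positivity)]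
    calc _ = (2 * K * cos α) * (m * K * (16 * N * psiU ψ ^ 2 * geom N c * γ)) := by ring
      _ ≤ (2 * K * cos α) * (eta c ^ 2 * psiL ψ * sin γ) := by gcongr
      _ ≤ (2 * K * cos α) * (1 * psiL ψ * sin γ) := by
          gcongr
          exact hη2.trans hη1
      _ = _ := by ring
  have q5 : ρ * m ≤ 1 / 2 := by
    rw [hρ, div_mul_eq_mul_div, div_le_iff₀ (by positivity)]
    calc 2 * K * psiL ψ * cos α * sin γ * m ≤ 2 * K * psiU ψ * 1 * γ * m := by gcongr
      _ = (m * K * psiU ψ) * 2 * γ := by ring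
      _ ≤ (1 / 16) * 2 * γ := by
          gcongr
          linarith
      _ ≤ 1 / 2 * (1 * γ) := by linarith
      _ ≤ 1 / 2 * (N * geom N c * γ) := by gcongr
  have q6 : 5 / 3 * G < ρ * (eta c * Dinf) := by
    have e : ρ * (eta c * Dinf) =
        2 * (K * (Dinf * eta c * psiL ψ * cos α * sin γ)) / (N * geom N c * γ) := by
      rw [hρ]
      ring
    rw [e, lt_div_iff₀ (by positivity)]
    have : 0 ≤ G * N * geom N c * γ := by positivity
    linarith
  have h0 : energyPhase ψ Ω m K α c (θ 0) (ω 0) < β := by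
    refine (energyPhase_le hψ hc1 hm hK.le hs.le hcos.le _ _).trans_lt ?_
    have := mul_nonneg hm.le (diam_nonneg (ω 0))
    rw [H1] at h1
    linarith
  obtain ⟨T, hT, hTD⟩ := hflow.exists_diam_phase_le hθ hω hψ hm hK.le hs.le hcos.le hc hγ hγ'.le
    hρ hρ0 hG hη hη1 q2 q4 q5 h0 (h2.beta_le hα hβ) hDβ hD q6
  -- The constant is `2 + 1/4`: `2 K ψ_u Dinf` from the sine coupling, and `G ≤ K ψ_u Dinf / 4` from
  -- the lower bound on `K`.
  have hF : ∀ t, T ≤ t → diam (force ψ Ω K α (θ t)) ≤ 9 / 4 * (K * psiU ψ * Dinf) := by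
    intro t ht
    have k1 := hψ.diam_force_le (Ω := Ω) hK.le hs.le hcos.le (θ t)
    rw [← hG] at k1
    have k2 : 2 * K * psiU ψ * cos α * diam (θ t) ≤ 2 * K * psiU ψ * 1 * Dinf := by
      have := diam_nonneg (θ t)
      gcongr
      exact hTD t ht
    have k3 : 4 * G ≤ K * psiU ψ * Dinf := by
      refine le_of_mul_le_mul_right ?_ hγ
      calc 4 * G * γ ≤ 4 * G * γ * (N * geom N c) := le_mul_of_one_le_right (by positivity) hW
        _ = 4 * G * N * geom N c * γ := by ring
        _ ≤ K * (Dinf * eta c * psiL ψ * cos α * sin γ) := p3.le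
        _ ≤ K * (Dinf * 1 * psiU ψ * 1 * γ) := by gcongr
        _ = _ := by ring
    linarith
  have hp : 0 < 4 * (m * K * psiU ψ) := by positivity
  -- Starts the bootstrap: the limiting bound on the frequency diameter lies below the threshold for
  -- `q = 3/2`. The factor `γ` in the bound on `m * K` cancels because `Dinf ≤ γ`.
  have hM : 9 / 4 * (K * psiU ψ * Dinf) < 3 / 2 * rate ψ K c / (4 * (m * K * psiU ψ)) := by
    have k : m * K * psiU ψ ^ 2 * 16 * Dinf * (N * geom N c) < psiL ψ := by
      refine lt_of_mul_lt_mul_right ?_ hγ.le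
      calc _ = m * K * (16 * N * psiU ψ ^ 2 * geom N c * γ) * Dinf := by ring
        _ < eta c ^ 2 * psiL ψ * sin γ * Dinf := by gcongr
        _ ≤ 1 * psiL ψ * 1 * γ := by
            gcongr
            · exact hη2.trans hη1
            · exact sin_le_one γ
        _ = _ := by ring
    rw [lt_div_iff₀ hp, rate, mul_div_assoc', lt_div_iff₀ (by positivity)]
    have k2 := mul_lt_mul_of_pos_left k hK
    have k3 : 0 < K * psiL ψ := by positivity
    linarith
  obtain ⟨T', hT'⟩ := Filter.eventually_atTop.1 (hflow.eventually_diam_freq_le hm hT hF hM)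
  have hTm : 0 < max T T' := lt_max_of_lt_left hT
  obtain ⟨tstar, hts, hdecay⟩ := hflow.exists_diam_freq_le_exp hθ hω hψ hm hK hc hTm
    (fun t ht i j => h2.two_le_mul_cos hα (hTD t ((le_max_left _ _).trans ht)) i j) hL hη hη1
    hrate q1 q3 fun t ht => by
      have := hT' t ((le_max_right _ _).trans ht)
      rw [le_div_iff₀ hp] at this
      linarith
  -- Since `tstar > 0`, the one-sided derivatives in `energy₂` are ordinary ones and agree with the
  -- acceleration and jerk fields.
  have henergy : energy₂ ψ m c ω tstar = energyFreq ψ Ω m K α c (θ tstar) (ω tstar) := by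
    rw [energy₂, hflow.dot_eq hts, hflow.dot_dot_eq hts, energyFreq]
  rw [← henergy] at hdecay
  -- The energy may vanish at `tstar`; the added `1` keeps the constant positive.
  refine ⟨hrate, tstar, hts.le, hdecay, |energy₂ ψ m c ω tstar / eta c| + 1, by positivity,
    fun t ht => (hdecay t ht).trans (mul_le_mul_of_nonneg_right ?_ (exp_pos _).le)⟩
  exact (le_abs_self _).trans (le_add_of_nonneg_right zero_le_one)
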